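/- Let $\lambda,d_0,\rho,\tau,R_c,w>0$ and $\alpha>2$ be reals, let $K,\zeta\ge 1$, $O\ge 0$ be integers, and put $M=K+O+\zeta-1$. Consider a downlink in $\mathbb R^2$ whose base stations (BSs) have $M$ antennas each and form a homogeneous Poisson point process of density $\lambda$. Each BS serves $K$ single-antenna users with equal power, nulls its interference at $O$ further users, and uses normalized zero-forcing (ZF) beams. At a BS which handles users $1,\dots,K+O$, with channels $\mathbf g_l$ and $\hat{\mathbf g}_l=\mathbf g_l/\|\mathbf g_l\|_2$, the beam of user $l$ is $(\mathbf I-\mathbf G\mathbf G^\dagger)\hat{\mathbf g}_l$ divided by its norm, where $\mathbf G$ has the columns $\hat{\mathbf g}_{l'}$, $l'\ne l$, and $\mathbf G^\dagger=(\mathbf G^{\sf H}\mathbf G)^{-1}\mathbf G^{\sf H}$. The channel of a link of length $r$ is $\sqrt{(1+r/d_0)^{-\alpha}}\,\mathbf h$. Fix a user at $u\in\mathbb R^2$. Under the idealization of a constant cluster size with complete nulling inside the cluster (the disc of radius $R_c$ around $u$), the following holds for this user. * The serving BS $b$ is the point closest to $u$ of a homogeneous Poisson process of density $\lambda$. It always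 counts as a BS of the cluster, so it is never an interferer; write $r_b$ for its distance from $u$. * The interfering BSs are exactly the BSs at distance more than $R_c$ from $u$. They form a Poisson process $\Phi_I$ of density $\lambda$ on the outside of the disc, independent of the process that determines the serving BS. * The small-scale fading is independent of all locations and independent over different links. The fading vectors $\mathbf h_{lb}$ from $b$ to the $K+O$ users which it handles, and $\mathbf h_m$ from the BS $m\in\Phi_I$ to the given user, are $\mathcal{CN}(\mathbf 0,\mathbf I_M)$. The given user is one of the $K$ users served by $b$; its fading vector is $\mathbf h_b$ and its beam is $\mathbf w_b$. * For each $m\in\Phi_I$ the channels of the users which it handles are orthogonal, in the sense that its $K$ beams $\mathbf w_{1m},\dots,\mathbf w_{Km}$ are orthonormal. Let $$\gamma=\frac{\rho(1+r_b/d_0)^{-\alpha}|\mathbf h_b^{\sf H}\mathbf w_b|^2}{\sum_{m\in\Phi_I}\sum_{k=1}^K\rho(1+r_m/d_0)^{-\alpha}|\mathbf h_m^{\sf H}\mathbf w_{km}|^2+1},\qquad R=\log_2\Bigl(1+\frac{\gamma}{\tau}\Bigr),$$ where $r_m$ is the distance of $m$ from $u$. Then $\mathbb P(r_b\le r)=F(r):=1-e^{-\lambda\pi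 r^2}$ for $r>0$, and for every $\kappa\ge 0$ $$\mathbb P(wR\ge\kappa)\le\int_0^\infty\sum_{j=1}^{\zeta}\binom{\zeta}{j}(-1)^{j+1}e^{-s}\exp\bigl(2\pi\lambda(\Psi_{\rm I}(s)-\Psi_{\rm II}(s))\bigr)\,\mathrm dF(r),$$ where the integral converges absolutely, $s=(\zeta!)^{-1/\zeta}\,j\,\frac{\tau}{\rho}\,(2^{\kappa/w}-1)\,(1+r/d_0)^{\alpha}$ and $$\Psi_{\rm I}(s)=\tfrac{d_0^2}{2}\Bigl(1+\tfrac{R_c}{d_0}\Bigr)^2\Bigl(1-{}_2F_1\bigl(K,-\tfrac2\alpha;1-\tfrac2\alpha;-s\rho(1+\tfrac{R_c}{d_0})^{-\alpha}\bigr)\Bigr),$$ $$\Psi_{\rm II}(s)=d_0^2\Bigl(1+\tfrac{R_c}{d_0}\Bigr)\Bigl(1-{}_2F_1\bigl(K,-\tfrac1\alpha;1-\tfrac1\alpha;-s\rho(1+\tfrac{R_c}{d_0})^{-\alpha}\bigr)\Bigr).$$ Here ${}_2F_1$ is the principal branch of the Gauss hypergeometric function on $\mathbb C\setminus[1,\infty)$.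 -/

import Mathlib

open MeasureTheory ProbabilityTheory Matrix
open scoped ENNReal NNReal Nat

namespace LSMIMO

noncomputable section

/-! ### The Gauss hypergeometric function on the cut plane -/

/-- The complex plane cut along `[1, ∞)`. -/
def cutPlane : Set ℂ := {z | ¬ (z.im = 0 ∧ 1 ≤ z.re)}

/-- `f` is the principal branch of `₂F₁(a, b; c; ·)`: it is holomorphic on the cut plane and equals
the sum of the hypergeometric series on the open unit disc.  By the identity theorem two such
functions agree on the cut plane. -/
def IsPrincipalBranch (a b c : ℂ) (f : ℂ → ℂ) : Prop :=
  DifferentiableOn ℂ f cutPlane ∧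
    ∀ z ∈ Metric.ball (0 : ℂ) 1, f z = ordinaryHypergeometric a b c z

open Classical in
/-- The Gauss hypergeometric function `₂F₁(a, b; c; z)`, continued analytically from the unit disc
to the plane cut along `[1, ∞)`.  (Mathlib's `ordinaryHypergeometric` is the sum of the series, and
takes a junk value outside the unit disc.) -/
def hyp2F1 (a b c z : ℂ) : ℂ :=
  if h : ∃ f : ℂ → ℂ, IsPrincipalBranch a b c f then h.choose z else 0

/-! ### Poisson point processes -/

/-- The plane `ℝ²` with its Euclidean distance and Lebesgue measure. -/
abbrev Plane : Type := EuclideanSpace ℝ (Fin 2)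

/-- The number of points of the enumerated configuration `x` that lie in `A`. -/
def count (x : ℕ → Plane) (A : Set Plane) : ℕ∞ := {m : ℕ | x m ∈ A}.encard

/-- `X` is a (measurable) enumeration of the points of a Poisson point process on the plane with
intensity measure `ν`: the number of points in a Borel set of finite intensity has the Poisson
distribution with mean `ν A`, and the numbers of points in disjoint Borel sets are independent.
(All intensity measures below have infinite mass, so that there are infinitely many points.) -/
structure IsPoissonProcess {Ω : Type*} [MeasurableSpace Ω] (P : Measure Ω) (ν : Measure Plane)
    (X : Ω → ℕ → Plane) : Prop where
  measurable : Measurable X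
  count_law : ∀ A : Set Plane, MeasurableSet A → ν A ≠ ∞ → ∀ n : ℕ,
    P {ω | count (X ω) A = n} = poissonMeasure (ν A).toNNReal {n}
  count_indep : ∀ (n : ℕ) (A : Fin n → Set Plane), (∀ i, MeasurableSet (A i)) →
    Pairwise (fun i j => Disjoint (A i) (A j)) →
    iIndepFun (fun i ω => count (X ω) (A i)) P

/-! ### Rayleigh fading and zero-forcing beams -/

/-- The circularly symmetric complex Gaussian law `CN(0, 1)`: the real and imaginary parts are
independent centred Gaussians of variance `1/2`. -/
def complexGaussian : Measure ℂ :=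
  ((gaussianReal 0 (1 / 2)).prod (gaussianReal 0 (1 / 2))).map
    Complex.measurableEquivRealProd.symm

instance : IsProbabilityMeasure complexGaussian :=
  Measure.isProbabilityMeasure_map Complex.measurableEquivRealProd.symm.measurable.aemeasurable

/-- The law `CN(0, I_M)` of a Rayleigh fading vector. -/
def rayleigh (M : ℕ) : Measure (Fin M → ℂ) := Measure.pi fun _ => complexGaussian

instance (M : ℕ) : IsProbabilityMeasure (rayleigh M) := by
  unfold rayleigh; infer_instance

/-- The vector `v` divided by its Euclidean norm. -/
def normalize {M : ℕ} (v : Fin M → ℂ) : Fin M → ℂ :=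
  ((‖WithLp.toLp 2 v‖⁻¹ : ℝ) : ℂ) • v

/-- The matrix whose columns are the normalized channels of all users but `i`. -/
def otherChannels {M : ℕ} {ι : Type*} (h : ι → Fin M → ℂ) (i : ι) :
    Matrix (Fin M) {l : ι // l ≠ i} ℂ :=
  Matrix.of fun a l => normalize (h l) a

/-- The left pseudo-inverse `(Gᴴ G)⁻¹ Gᴴ`. -/
def leftPinv {M : ℕ} {ι : Type*} [Fintype ι] [DecidableEq ι] (G : Matrix (Fin M) ι ℂ) :
    Matrix ι (Fin M) ℂ :=
  (Gᴴ * G)⁻¹ * Gᴴ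

/-- The normalized zero-forcing beam for user `i` at a base station with `M` antennas, where `h l`
is the small-scale fading vector of the channel to user `l`.  The channel itself is a positive
multiple (the square root of the path loss) of the fading vector, so that `normalize (h l)` is also
the normalized channel. -/
def zfBeam {M : ℕ} {ι : Type*} [Fintype ι] [DecidableEq ι] (h : ι → Fin M → ℂ) (i : ι) :
    Fin M → ℂ :=
  normalize
    ((1 - otherChannels h i * leftPinv (otherChannels h i)) *ᵥ normalize (h i))

/-- The received power `|hᴴ w|²`. -/
def power {M : ℕ} (h w : Fin M → ℂ) : ℝ := ‖star h ⬝ᵥ w‖ ^ 2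

/-! ### The downlink with user-centric nulling -/

/-- The real parameters: base-station density `lam`, path-loss exponent `alpha`, reference distance
`d0`, per-user signal-to-noise ratio `rho`, gap to capacity `tau`, cluster radius `Rc`, fraction of
time `w` for which a user is served. -/
structure Params where
  lam : ℝ
  alpha : ℝ
  d0 : ℝ
  rho : ℝ
  tau : ℝ
  Rc : ℝ
  w : ℝ

/-- The admissible values of the parameters. -/
structure Params.Valid (p : Params) : Prop where
  lam_pos : 0 < p.lam
  alpha_gt : 2 < p.alpha
  d0_pos : 0 < p.d0
  rho_pos : 0 < p.rho
  tau_pos : 0 < p.tau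
  Rc_pos : 0 < p.Rc
  w_pos : 0 < p.w

/-- The path loss `(1 + r / d₀)^(-α)` at distance `r`. -/
def Params.pathLoss (p : Params) (r : ℝ) : ℝ := (1 + r / p.d0) ^ (-p.alpha)

/-- The random elements seen by one user. Each base station has `M` antennas, serves `K` users
(indexed by `Fin K`) and nulls its interference at `O` further users (indexed by `Fin O`).

* `near`: the points among which the user selects the closest one as its base station;
* `far`: the base stations outside the cluster of the user;
* `own`: fading from the serving base station to the `K + O` users it serves or nulls;
* `cross`: fading from the base station `far m` to the given user;
* `other`: fading from the base station `far m` to the `K + O` users which that station serves or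
  nulls. -/
structure Network (Ω : Type*) (M K O : ℕ) where
  near : Ω → ℕ → Plane
  far : Ω → ℕ → Plane
  own : Ω → Fin K ⊕ Fin O → Fin M → ℂ
  cross : Ω → ℕ → Fin M → ℂ
  other : Ω → ℕ → Fin K ⊕ Fin O → Fin M → ℂ

/-- The probabilistic model for a user at `u`, under the idealization that the cluster of the user,
i.e. the set of base stations within distance `Rc`, has a constant size.

The base stations form a homogeneous Poisson process of density `lam`: they are the points of `near`
in the cluster disc and the points of `far`, which fill the outside of the disc; the superposition
of these independent parts is a Poisson process of density `lam` on the plane. The serving station is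
the point of `near` closest to the user, and it is a station of the cluster whenever the cluster is
not empty. The idealization is that a serving station always belongs to the cluster: it is never one
of the interferers, and its distance from the user carries no information about them.

The fading does not depend on the locations, the fading on different links is independent, and the
fading from the serving station to its users and from each interferer to the given user is
Rayleigh. The users handled by an interferer have orthogonal channels, in the sense that the beams
of the interferer are orthonormal. -/
structure Network.Model {Ω : Type*} [MeasurableSpace Ω] {M K O : ℕ} (N : Network Ω M K O)
    (P : Measure Ω) (p : Params) (u : Plane) : Prop where
  near_poisson : IsPoissonProcess P (ENNReal.ofReal p.lam • volume) N.near
  far_poisson : IsPoissonProcess P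
    (ENNReal.ofReal p.lam • volume.restrict {x | p.Rc < dist x u}) N.far
  own_law : HasLaw N.own (Measure.pi fun _ => rayleigh M) P
  cross_law : HasLaw N.cross (Measure.infinitePi fun _ => rayleigh M) P
  other_measurable : Measurable N.other
  other_orthonormal : ∀ᵐ ω ∂P, ∀ (m : ℕ) (k l : Fin K),
    star (zfBeam (N.other ω m) (Sum.inl k)) ⬝ᵥ zfBeam (N.other ω m) (Sum.inl l) =
      if k = l then 1 else 0
  indep_near_far : IndepFun N.near N.far P
  indep_location_fading : IndepFun (fun ω => (N.near ω, N.far ω))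
    (fun ω => (N.own ω, N.cross ω, N.other ω)) P
  indep_own : IndepFun N.own (fun ω => (N.cross ω, N.other ω)) P
  indep_cross_other : IndepFun N.cross N.other P

section

variable {Ω : Type*} {M K O : ℕ} (N : Network Ω M K O) (p : Params) (u : Plane)

/-- The distance from the user to its base station, which is the closest one. -/
def Network.rmin (ω : Ω) : ℝ := ⨅ m, dist (N.near ω m) u

/-- The received signal power of the scheduled user `i`, relative to the noise power. -/
def Network.signal (i : Fin K) (ω : Ω) : ℝ :=
  p.rho * p.pathLoss (N.rmin u ω) *
    power (N.own ω (Sum.inl i)) (zfBeam (N.own ω) (Sum.inl i))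

/-- The aggregate interference power, relative to the noise power, from all base stations outside
the cluster; there is no interference from inside the cluster or from inside the cell. -/
def Network.interference (ω : Ω) : ℝ≥0∞ :=
  ∑' m : ℕ, ENNReal.ofReal (∑ k : Fin K,
    p.rho * p.pathLoss (dist (N.far ω m) u) *
      power (N.cross ω m) (zfBeam (N.other ω m) (Sum.inl k)))

/-- The signal-to-interference-plus-noise ratio. -/
def Network.sinr (i : Fin K) (ω : Ω) : ℝ :=
  (ENNReal.ofReal (N.signal p u i ω) / (N.interference p u ω + 1)).toReal

/-- The achievable rate in bit/s/Hz. -/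
def Network.rate (i : Fin K) (ω : Ω) : ℝ :=
  Real.logb 2 (1 + N.sinr p u i ω / p.tau)

end

/-! ### The expressions in the bound -/

/-- `F(r) = 1 - exp(-λ π r²)`. -/
def Params.cdfNearest (p : Params) (r : ℝ) : ℝ :=
  1 - Real.exp (-(p.lam * Real.pi * r ^ 2))

/-- The argument `s`, which depends on `j` and `r`. -/
def Params.sArg (p : Params) (ζ : ℕ) (κ : ℝ) (j : ℕ) (r : ℝ) : ℝ :=
  (ζ ! : ℝ) ^ (-1 / (ζ : ℝ)) * j * (p.tau / p.rho) * ((2 : ℝ) ^ (κ / p.w) - 1) *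
    (1 + r / p.d0) ^ p.alpha

/-- The function `Ψ_I`. -/
def Params.PsiI (p : Params) (K : ℕ) (s : ℝ) : ℝ :=
  p.d0 ^ 2 / 2 * (1 + p.Rc / p.d0) ^ 2 *
    (1 - (hyp2F1 (K : ℂ) ((-(2 / p.alpha) : ℝ) : ℂ) ((1 - 2 / p.alpha : ℝ) : ℂ)
      ((-(s * p.rho * (1 + p.Rc / p.d0) ^ (-p.alpha)) : ℝ) : ℂ)).re)

/-- The function `Ψ_II`. -/
def Params.PsiII (p : Params) (K : ℕ) (s : ℝ) : ℝ :=
  p.d0 ^ 2 * (1 + p.Rc / p.d0) *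
    (1 - (hyp2F1 (K : ℂ) ((-(1 / p.alpha) : ℝ) : ℂ) ((1 - 1 / p.alpha : ℝ) : ℂ)
      ((-(s * p.rho * (1 + p.Rc / p.d0) ^ (-p.alpha)) : ℝ) : ℂ)).re)

/-- The integrand of the bound, before multiplication with the density of the distance. -/
def Params.integrand (p : Params) (K ζ : ℕ) (κ r : ℝ) : ℝ :=
  ∑ j ∈ Finset.Icc 1 ζ, (ζ.choose j : ℝ) * (-1) ^ (j + 1) * Real.exp (-(p.sArg ζ κ j r)) *
    Real.exp (2 * Real.pi * p.lam *
      (p.PsiI K (p.sArg ζ κ j r) - p.PsiII K (p.sArg ζ κ j r)))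

end

end LSMIMO

namespace LSMIMO

noncomputable section

open Filter Topology

/-! Freeze everything except the fading at the serving station. Zero-forcing keeps exactly the
projection of the user's channel on the orthogonal complement of the other `K + O - 1` channels
(`exists_power_zfBeam`). These are almost surely independent, so the complement has dimension `ζ`. A
Rayleigh vector projects on an orthonormal family as independent standard Gaussians
(`map_rayleigh_orthonormal`), so the beam power is a sum of `ζ` independent unit exponentials
(`measure_le_power_zfBeam`).

The rate event forces this power above a threshold `x` proportional to `(1 + r_b/d₀)^α (I + 1)`,
where `I` is the interference. Alzer's inequality (`erlangTail_le`) bounds the tail by `1 - (1 -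
e^{-cx})^ζ` with `c = (ζ!)^{-1/ζ}`. This is the source of the inequality; what follows is exact. The
binomial theorem turns the bound into a combination of the exponentials `e^{-s_j (I + 1)}`, with
`s_j` linear in `j`. Since the location of the serving station is independent of `I`, averaging
gives the Laplace transform of `I + 1` integrated against the law of `r_b`, and that law is the void
probability of a disc (`Network.Model.map_rmin`).

For the Laplace transform of `I`, average first over the fading of the interferers. Each has `K`
orthonormal beams, hence contributes the factor `(1 + sρℓ)^{-K}` with `ℓ` its path loss, whatever
the beams are. The Laplace functional of the Poisson process (`IsPoissonProcess.laplace`) and polar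
coordinates leave a radial integral. A power substitution splits it into two Euler integrals
(`radial_integral`), which represent the hypergeometric function on the whole cut plane by the
identity theorem (`hyp2F1_eq`).

Exponentials take extended nonnegative arguments throughout, so finiteness of the interference never
has to be proved. -/

/-- `e^{-x}` for extended nonnegative `x`, with `e^{-∞} = 0`. -/
def expNeg (x : ℝ≥0∞) : ℝ≥0∞ := EReal.exp (-(x : EReal))

@[simp] lemma expNeg_zero : expNeg 0 = 1 := by simp [expNeg]

lemma expNeg_ofReal {x : ℝ} (hx : 0 ≤ x) :
    expNeg (ENNReal.ofReal x) = ENNReal.ofReal (Real.exp (-x)) := by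
  rw [expNeg, EReal.coe_ennreal_ofReal, max_eq_left hx, ← EReal.coe_neg, EReal.exp_coe]

lemma expNeg_add (x y : ℝ≥0∞) : expNeg (x + y) = expNeg x * expNeg y := by
  simp only [expNeg, EReal.coe_ennreal_add, ← EReal.exp_add]
  rw [EReal.neg_add (Or.inl (by simp)) (Or.inr (by simp)), sub_eq_add_neg]

lemma expNeg_sum {ι : Type*} (s : Finset ι) (f : ι → ℝ≥0∞) :
    expNeg (∑ i ∈ s, f i) = ∏ i ∈ s, expNeg (f i) := by
  classical
  induction s using Finset.induction_on with
  | empty => simp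
  | insert a s ha ih => rw [Finset.sum_insert ha, Finset.prod_insert ha, expNeg_add, ih]

lemma continuous_expNeg : Continuous expNeg :=
  ENNReal.continuous_exp.comp (continuous_neg.comp continuous_coe_ennreal_ereal)

lemma measurable_expNeg : Measurable expNeg := continuous_expNeg.measurable

lemma antitone_expNeg : Antitone expNeg := fun _ _ h =>
  EReal.exp_monotone (EReal.neg_le_neg_iff.2 (EReal.coe_ennreal_le_coe_ennreal_iff.2 h))

lemma expNeg_le_one (x : ℝ≥0∞) : expNeg x ≤ 1 := expNeg_zero ▸ antitone_expNeg zero_le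

lemma expNeg_ne_top (x : ℝ≥0∞) : expNeg x ≠ ∞ := ((expNeg_le_one x).trans_lt ENNReal.one_lt_top).ne

lemma expNeg_eq_ofReal {x : ℝ≥0∞} (hx : x ≠ ∞) :
    expNeg x = ENNReal.ofReal (Real.exp (-x.toReal)) := by
  rw [← expNeg_ofReal ENNReal.toReal_nonneg, ENNReal.ofReal_toReal hx]

/-! ### Laplace functional of a Poisson process -/

lemma toENNReal_count (x : ℕ → Plane) (A : Set Plane) :
    (count x A : ℝ≥0∞) = ∑' m, A.indicator (fun _ => 1) (x m) := by
  rw [count, ← ENNReal.tsum_set_one, tsum_subtype (f := fun _ => (1 : ℝ≥0∞))]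
  rfl

variable {Ω : Type*} [MeasurableSpace Ω] {P : Measure Ω} {ν : Measure Plane}
  {X : Ω → ℕ → Plane}

lemma measurable_count (hX : Measurable X) {A : Set Plane} (hA : MeasurableSet A) :
    Measurable (fun ω => count (X ω) A) := by
  have h : Measurable fun ω => (count (X ω) A : ℝ≥0∞) := by
    simp_rw [toENNReal_count]
    refine Measurable.tsum fun m => ?_
    exact (measurable_const.indicator hA).comp ((measurable_pi_apply m).comp hX)
  refine measurable_to_countable' fun n => ?_
  have := h (measurableSet_singleton ((n : ℕ∞) : ℝ≥0∞))
  convert this using 1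
  ext ω
  simp

/-- The count law only prescribes the masses at finite values. Both measures have total mass one, so
the remaining mass, at `⊤`, agrees as well. -/
lemma IsPoissonProcess.map_count [IsProbabilityMeasure P] (hX : IsPoissonProcess P ν X)
    {A : Set Plane} (hA : MeasurableSet A) (hν : ν A ≠ ∞) :
    P.map (fun ω => count (X ω) A) =
      (poissonMeasure (ν A).toNNReal).map (Nat.cast : ℕ → ℕ∞) := by
  have hc := measurable_count hX.measurable hA
  have hn : Measurable (Nat.cast : ℕ → ℕ∞) := measurable_from_top
  have : IsProbabilityMeasure (P.map (fun ω => count (X ω) A)) :=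
    Measure.isProbabilityMeasure_map hc.aemeasurable
  have : IsProbabilityMeasure ((poissonMeasure (ν A).toNNReal).map (Nat.cast : ℕ → ℕ∞)) :=
    Measure.isProbabilityMeasure_map hn.aemeasurable
  have key : ∀ n : ℕ, P.map (fun ω => count (X ω) A) {(n : ℕ∞)} =
      (poissonMeasure (ν A).toNNReal).map (Nat.cast : ℕ → ℕ∞) {(n : ℕ∞)} := by
    intro n
    rw [Measure.map_apply hc (measurableSet_singleton _),
      Measure.map_apply hn (measurableSet_singleton _)]
    have h : (Nat.cast : ℕ → ℕ∞) ⁻¹' {(n : ℕ∞)} = {n} := by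
      ext k
      simp
    rw [h]
    exact hX.count_law A hA hν n
  have hun : ({⊤}ᶜ : Set ℕ∞) = ⋃ n : ℕ, {(n : ℕ∞)} := by
    ext k
    induction k using ENat.recTopCoe <;> simp
  have hcompl : P.map (fun ω => count (X ω) A) {⊤}ᶜ =
      (poissonMeasure (ν A).toNNReal).map (Nat.cast : ℕ → ℕ∞) {⊤}ᶜ := by
    rw [hun, measure_iUnion, measure_iUnion]
    · exact tsum_congr key
    all_goals first
      | exact fun _ => measurableSet_singleton _
      | exact fun i j hij => by simpa using hij
  refine Measure.ext_of_singleton fun k => ?_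
  induction k using ENat.recTopCoe with
  | coe n => exact key n
  | top =>
    have hm : MeasurableSet ({⊤}ᶜ : Set ℕ∞) := (measurableSet_singleton _).compl
    rw [← compl_compl ({⊤} : Set ℕ∞), prob_compl_eq_one_sub hm, hcompl, ← prob_compl_eq_one_sub hm]

lemma lintegral_expNeg_poissonMeasure (r : ℝ≥0) (c : ℝ≥0) :
    ∫⁻ n, expNeg (c * (n : ℝ≥0∞)) ∂(poissonMeasure r) = expNeg (r * (1 - expNeg c)) := by
  have hc : expNeg c = ENNReal.ofReal (Real.exp (-c)) := by
    rw [expNeg_eq_ofReal ENNReal.coe_ne_top]; simp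
  have h1 : (r : ℝ≥0∞) * (1 - expNeg c) = ENNReal.ofReal (r * (1 - Real.exp (-c))) := by
    rw [hc, ENNReal.ofReal_mul r.coe_nonneg, ENNReal.ofReal_sub _ (Real.exp_pos _).le]
    simp
  have h2 : 0 ≤ (r : ℝ) * (1 - Real.exp (-c)) :=
    mul_nonneg r.coe_nonneg (sub_nonneg.2 (Real.exp_le_one_iff.2 (by simp)))
  rw [h1, expNeg_ofReal h2, lintegral_countable']
  have h3 : HasSum (fun n : ℕ => Real.exp (-r) * ((r * Real.exp (-c)) ^ n / (n ! : ℝ)))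
      (Real.exp (-r) * Real.exp (r * Real.exp (-c))) := by
    refine HasSum.mul_left _ ?_
    rw [Real.exp_eq_exp_ℝ]
    exact NormedSpace.expSeries_div_hasSum_exp (𝔸 := ℝ) _
  have h4 : ∀ n : ℕ, expNeg (c * (n : ℝ≥0∞)) * poissonMeasure r {n} =
      ENNReal.ofReal (Real.exp (-r) * ((r * Real.exp (-c)) ^ n / (n ! : ℝ))) := by
    intro n
    have : (c * (n : ℝ≥0∞)) = ENNReal.ofReal (c * n) := by
      rw [ENNReal.ofReal_mul c.coe_nonneg]; simp
    rw [this, expNeg_ofReal (by positivity), poissonMeasure_singleton,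
      ← ENNReal.ofReal_mul (by positivity)]
    congr 1
    rw [mul_pow, ← Real.exp_nat_mul]
    rw [show (n : ℝ) * -(c : ℝ) = -(c * n) by ring]
    ring
  simp_rw [h4]
  rw [← ENNReal.ofReal_tsum_of_nonneg (fun n => by positivity) h3.summable, h3.tsum_eq,
    ← Real.exp_add]
  congr 2
  ring

lemma IsPoissonProcess.lintegral_expNeg_count [IsProbabilityMeasure P]
    (hX : IsPoissonProcess P ν X) {A : Set Plane} (hA : MeasurableSet A) (hν : ν A ≠ ∞) (c : ℝ≥0) :
    ∫⁻ ω, expNeg (c * (count (X ω) A : ℝ≥0∞)) ∂P = expNeg (ν A * (1 - expNeg c)) := by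
  have h := lintegral_map (μ := P) (f := fun k : ℕ∞ => expNeg (c * (k : ℝ≥0∞)))
    measurable_from_top (measurable_count hX.measurable hA)
  rw [← h, hX.map_count hA hν, lintegral_map measurable_from_top measurable_from_top]
  simp only [ENat.toENNReal_coe]
  rw [lintegral_expNeg_poissonMeasure, ENNReal.coe_toNNReal hν]

lemma measurable_tsum_comp (hX : Measurable X) {f : Plane → ℝ≥0∞} (hf : Measurable f) :
    Measurable fun ω => ∑' m, f (X ω m) :=
  Measurable.tsum fun m => hf.comp ((measurable_pi_apply m).comp hX)

/-- The level sets of `f` are disjoint, so the sum over the points is a combination of independent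
Poisson counts, and the expectation factors into Poisson generating functions. -/
lemma IsPoissonProcess.laplace_simpleFunc [IsProbabilityMeasure P]
    (hX : IsPoissonProcess P ν X) (f : SimpleFunc Plane ℝ≥0∞) (hf : ∀ x, f x ≠ ∞)
    (hν : ∀ y ≠ 0, ν (f ⁻¹' {y}) ≠ ∞) :
    ∫⁻ ω, expNeg (∑' m, f (X ω m)) ∂P = expNeg (∫⁻ x, (1 - expNeg (f x)) ∂ν) := by
  classical
  -- The value 0 contributes nothing to either side, and its level set may have infinite intensity,
  -- where the count has no prescribed law.
  set R := f.range.erase 0 with hR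
  have h1 : ∀ x, f x = ∑ y ∈ R, y * (f ⁻¹' {y}).indicator (fun _ => 1) x := by
    intro x
    by_cases hx : f x = 0
    · rw [hx, Finset.sum_eq_zero]
      intro y hy
      have : y ≠ 0 := Finset.ne_of_mem_erase hy
      simp [hx, this.symm]
    · rw [Finset.sum_eq_single (f x)]
      · simp
      · intro y _ hy
        simp [hy.symm]
      · intro h
        exact absurd (Finset.mem_erase.2 ⟨hx, f.mem_range_self x⟩) h
  have h2 : ∀ x : ℕ → Plane,
      ∑' m, f (x m) = ∑ y ∈ R, y * (count x (f ⁻¹' {y}) : ℝ≥0∞) := by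
    intro x
    simp_rw [toENNReal_count, ← ENNReal.tsum_mul_left]
    rw [← Summable.tsum_finsetSum fun _ _ => ENNReal.summable]
    exact tsum_congr fun m => h1 _
  have hRt : ∀ y ∈ R, y ≠ ∞ := by
    intro y hy
    obtain ⟨x, rfl⟩ := SimpleFunc.mem_range.1 (Finset.mem_of_mem_erase hy)
    exact hf x
  have h3 : ∫⁻ x, (1 - expNeg (f x)) ∂ν = ∑ y ∈ R, ν (f ⁻¹' {y}) * (1 - expNeg y) := by
    have := (f.map fun y => 1 - expNeg y).lintegral_eq_lintegral ν
    simp only [SimpleFunc.coe_map, Function.comp] at this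
    rw [this, SimpleFunc.map_lintegral, hR]
    rw [← Finset.sum_erase (a := 0) f.range (by simp)]
    exact Finset.sum_congr rfl fun y _ => mul_comm _ _
  let e : Fin R.card ≃ R := R.equivFin.symm
  have hA : ∀ i, MeasurableSet (f ⁻¹' {(e i : ℝ≥0∞)}) := fun i => f.measurableSet_fiber _
  have hind := hX.count_indep R.card (fun i => f ⁻¹' {(e i : ℝ≥0∞)}) hA (by
    intro i j hij
    refine Disjoint.preimage _ ?_
    simpa [Subtype.ext_iff] using fun h => hij (e.injective (Subtype.ext h)))
  have hind2 := hind.comp (fun i (k : ℕ∞) => expNeg ((e i : ℝ≥0∞) * (k : ℝ≥0∞)))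
    (fun i => measurable_from_top)
  have h4 := lintegral_prod_eq_prod_lintegral_of_indepFun Finset.univ _ hind2 (fun i =>
    (measurable_from_top (f := fun k : ℕ∞ => expNeg ((e i : ℝ≥0∞) * (k : ℝ≥0∞)))).comp
      (measurable_count hX.measurable (hA i)))
  simp_rw [h2]
  have h5 : ∀ g : ℝ≥0∞ → ℝ≥0∞, ∏ y ∈ R, g y = ∏ i, g (e i) := fun g => by
    rw [← Finset.prod_coe_sort, ← e.prod_comp]
  simp_rw [h3, expNeg_sum, h5]
  simp only [Function.comp] at h4
  rw [h4]
  refine Finset.prod_congr rfl fun i _ => ?_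
  have hy := (e i).2
  have := hX.lintegral_expNeg_count (hA i) (hν _ (Finset.ne_of_mem_erase hy))
    (e i : ℝ≥0∞).toNNReal
  rwa [ENNReal.coe_toNNReal (hRt _ hy)] at this

/-- The Laplace functional of a Poisson process. -/
theorem IsPoissonProcess.laplace [IsProbabilityMeasure P] [SigmaFinite ν]
    (hX : IsPoissonProcess P ν X) {f : Plane → ℝ≥0∞} (hf : Measurable f) :
    ∫⁻ ω, expNeg (∑' m, f (X ω m)) ∂P = expNeg (∫⁻ x, (1 - expNeg (f x)) ∂ν) := by
  let S := spanningSets ν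
  have hS : ∀ n, MeasurableSet (S n) := measurableSet_spanningSets ν
  -- The cut-off by spanning sets gives every nonzero level set finite intensity; `eapprox` takes
  -- finite values only.
  let g : ℕ → SimpleFunc Plane ℝ≥0∞ := fun n => (SimpleFunc.eapprox f n).restrict (S n)
  have hg : ∀ n x, g n x = (S n).indicator (SimpleFunc.eapprox f n) x := fun n x => by
    rw [SimpleFunc.restrict_apply _ (hS n)]
  have hmono : Monotone g := by
    intro m n hmn x
    rw [hg, hg]
    by_cases hx : x ∈ S m
    · rw [Set.indicator_of_mem hx, Set.indicator_of_mem (monotone_spanningSets ν hmn hx)]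
      exact SimpleFunc.monotone_eapprox f hmn x
    · simp [Set.indicator_of_notMem hx]
  have hlim : ∀ x, Tendsto (fun n => g n x) atTop (𝓝 (f x)) := by
    intro x
    have h1 : Tendsto (fun n => SimpleFunc.eapprox f n x) atTop (𝓝 (f x)) := by
      rw [← SimpleFunc.iSup_eapprox_apply hf x]
      exact tendsto_atTop_iSup fun m n hmn => SimpleFunc.monotone_eapprox f hmn x
    refine h1.congr' ?_
    obtain ⟨k, hk⟩ : ∃ k, x ∈ S k := by
      have : x ∈ ⋃ n, S n := by rw [iUnion_spanningSets]; trivial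
      simpa using this
    filter_upwards [eventually_ge_atTop k] with n hn
    rw [hg, Set.indicator_of_mem (monotone_spanningSets ν hn hk)]
  have hstep : ∀ n, ∫⁻ ω, expNeg (∑' m, g n (X ω m)) ∂P =
      expNeg (∫⁻ x, (1 - expNeg (g n x)) ∂ν) := by
    intro n
    refine hX.laplace_simpleFunc (g n) (fun x => ?_) fun y hy => ?_
    · rw [hg]
      by_cases hx : x ∈ S n
      · rw [Set.indicator_of_mem hx]; exact (SimpleFunc.eapprox_lt_top f n x).ne
      · simp [Set.indicator_of_notMem hx]
    · refine ((measure_mono fun x hx => ?_).trans_lt (measure_spanningSets_lt_top ν n)).ne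
      by_contra hxS
      refine hy ?_
      rw [← (show g n x = y from hx), hg, Set.indicator_of_notMem hxS]
  have hleft : Tendsto (fun n => ∫⁻ ω, expNeg (∑' m, g n (X ω m)) ∂P) atTop
      (𝓝 (∫⁻ ω, expNeg (∑' m, f (X ω m)) ∂P)) := by
    refine tendsto_lintegral_of_dominated_convergence (fun _ => 1) (fun n =>
      measurable_expNeg.comp (measurable_tsum_comp hX.measurable (g n).measurable))
      (fun n => Eventually.of_forall fun ω => expNeg_le_one _) (by simp)
      (Eventually.of_forall fun ω => (continuous_expNeg.tendsto _).comp ?_)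
    -- For fixed `ω` the sum over the points is an integral against counting measure, so monotone
    -- convergence applies.
    have := lintegral_tendsto_of_tendsto_of_monotone (μ := Measure.count)
      (f := fun n m => g n (X ω m)) (F := fun m => f (X ω m))
      (fun n => measurable_from_top.aemeasurable)
      (Eventually.of_forall fun m a b hab => hmono hab _)
      (Eventually.of_forall fun m => hlim _)
    simpa only [lintegral_count] using this
  have hright : Tendsto (fun n => ∫⁻ x, (1 - expNeg (g n x)) ∂ν) atTop
      (𝓝 (∫⁻ x, (1 - expNeg (f x)) ∂ν)) := by
    refine lintegral_tendsto_of_tendsto_of_monotone (fun n =>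
      (measurable_const.sub (measurable_expNeg.comp (g n).measurable)).aemeasurable)
      (Eventually.of_forall fun x a b hab => tsub_le_tsub_left (antitone_expNeg (hmono hab x)) _)
      (Eventually.of_forall fun x => ?_)
    exact ENNReal.Tendsto.sub tendsto_const_nhds ((continuous_expNeg.tendsto _).comp (hlim x))
      (Or.inl ENNReal.one_ne_top)
  refine tendsto_nhds_unique hleft ?_
  simp_rw [hstep]
  exact (continuous_expNeg.tendsto _).comp hright

/-! ### Rayleigh fading -/

lemma charFun_complexGaussian (t : ℂ) :
    charFun complexGaussian t = Complex.exp (-(‖t‖ ^ 2 / 4 : ℝ)) := by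
  have h : ∀ x : ℝ × ℝ, Complex.exp (((inner ℝ (Complex.measurableEquivRealProd.symm x) t : ℝ) : ℂ)
      * Complex.I) = Complex.exp (t.re * x.1 * Complex.I) * Complex.exp (t.im * x.2 * Complex.I) := by
    intro x
    rw [← Complex.exp_add]
    congr 1
    simp [Complex.inner, Complex.measurableEquivRealProd]
    ring
  rw [charFun_apply, complexGaussian, integral_map_equiv]
  simp_rw [h]
  rw [integral_prod_mul (fun x : ℝ => Complex.exp (t.re * x * Complex.I))
    (fun x : ℝ => Complex.exp (t.im * x * Complex.I)), ← charFun_apply_real, ← charFun_apply_real,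
    charFun_gaussianReal, charFun_gaussianReal, ← Complex.exp_add]
  congr 1
  rw [Complex.sq_norm, Complex.normSq_apply]
  push_cast
  ring

/-- The characteristic function of a Rayleigh vector depends on the norm of the argument only. This
is the unitary invariance behind `map_rayleigh_orthonormal`. -/
lemma integral_cexp_inner_rayleigh {M : ℕ} (v : Fin M → ℂ) :
    ∫ h, Complex.exp (((∑ a, inner ℝ (h a) (v a) : ℝ) : ℂ) * Complex.I) ∂(rayleigh M) =
      Complex.exp (-((∑ a, ‖v a‖ ^ 2) / 4 : ℝ)) := by
  simp_rw [Complex.ofReal_sum, Finset.sum_mul, Complex.exp_sum]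
  rw [rayleigh, integral_fintype_prod_eq_prod
    (f := fun a x => Complex.exp (((inner ℝ x (v a) : ℝ) : ℂ) * Complex.I))]
  simp_rw [← charFun_apply, charFun_complexGaussian]
  rw [← Complex.exp_sum]
  congr 1
  push_cast
  rw [Finset.sum_neg_distrib, Finset.sum_div]

/-- The projections of a Rayleigh fading vector on an orthonormal family are independent standard
complex Gaussian variables. -/
theorem map_rayleigh_orthonormal {M : ℕ} {ι : Type*} [Fintype ι] [DecidableEq ι]
    (w : ι → Fin M → ℂ) (hw : ∀ k l, star (w k) ⬝ᵥ w l = if k = l then 1 else 0) :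
    (rayleigh M).map (fun h k => star h ⬝ᵥ w k) = Measure.pi fun _ : ι => complexGaussian := by
  have hmeas : Measurable fun (h : Fin M → ℂ) (k : ι) => star h ⬝ᵥ w k := by
    refine measurable_pi_lambda _ fun k => ?_
    simp only [dotProduct, Pi.star_apply]
    refine Finset.measurable_sum _ fun a _ => ?_
    have hs : Measurable fun z : ℂ => star z := continuous_star.measurable
    exact (hs.comp (measurable_pi_apply a)).mul_const _
  have : IsProbabilityMeasure ((rayleigh M).map (fun h k => star h ⬝ᵥ w k)) :=
    Measure.isProbabilityMeasure_map hmeas.aemeasurable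
  rw [← charFun_eq_pi_iff]
  intro t
  -- The adjoint of the projection map; `t` appears conjugated because `h` is conjugated in the dot
  -- product.
  have hinner : ∀ h : Fin M → ℂ, (∑ k, inner ℝ (star h ⬝ᵥ w k) (t k) : ℝ) =
      ∑ a, inner ℝ (h a) (∑ k, w k a * star (t k)) := by
    intro h
    simp_rw [inner_sum]
    rw [Finset.sum_comm]
    refine Finset.sum_congr rfl fun k _ => ?_
    rw [dotProduct, sum_inner]
    refine Finset.sum_congr rfl fun a _ => ?_
    simp [Complex.inner]
    ring
  rw [charFun_apply, ← MeasurableEquiv.coe_toLp, integral_map_equiv,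
    integral_map hmeas.aemeasurable (by
      refine Measurable.aestronglyMeasurable ?_
      exact ((by fun_prop : Measurable fun x : WithLp 2 (ι → ℂ) =>
        Complex.exp (((inner ℝ x t : ℝ) : ℂ) * Complex.I))).comp (MeasurableEquiv.measurable _))]
  simp only [MeasurableEquiv.coe_toLp, PiLp.inner_apply]
  simp_rw [hinner]
  rw [integral_cexp_inner_rayleigh]
  simp_rw [charFun_complexGaussian]
  rw [← Complex.exp_sum]
  congr 1
  rw [Finset.sum_neg_distrib, ← Complex.ofReal_sum, Finset.sum_div]
  congr 2
  rw [← Finset.sum_div, ← Finset.sum_div]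
  congr 1
  -- Orthonormality makes this adjoint norm-preserving, so the two characteristic functions
  -- coincide.
  have key : ((∑ a, ‖∑ k, w k a * star (t k)‖ ^ 2 : ℝ) : ℂ) = ((∑ k, ‖t k‖ ^ 2 : ℝ) : ℂ) := by
    push_cast
    simp_rw [← Complex.conj_mul', map_sum, map_mul, Finset.sum_mul_sum]
    rw [Finset.sum_comm]
    refine Finset.sum_congr rfl fun k _ => ?_
    rw [Finset.sum_comm]
    have : ∀ l, ∑ a, (starRingEnd ℂ) (w k a) * (starRingEnd ℂ) (star (t k)) * (w l a * star (t l))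
        = (t k * star (t l)) * (star (w k) ⬝ᵥ w l) := by
      intro l
      rw [dotProduct, Finset.mul_sum]
      refine Finset.sum_congr rfl fun a _ => ?_
      simp
      ring
    simp_rw [this, hw]
    simp [mul_comm]
  exact_mod_cast key

/-! ### Exponential and Erlang laws of fading powers -/

/-- The exponential law of rate one. -/
def expLaw : Measure ℝ :=
  (volume.restrict (Set.Ioi 0)).withDensity fun t => ENNReal.ofReal (Real.exp (-t))

lemma lintegral_expLaw {f : ℝ → ℝ≥0∞} (hf : Measurable f) :
    ∫⁻ t, f t ∂expLaw = ∫⁻ t in Set.Ioi 0, ENNReal.ofReal (Real.exp (-t)) * f t := by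
  rw [expLaw, lintegral_withDensity_eq_lintegral_mul _ (by fun_prop) hf]
  rfl

instance : IsProbabilityMeasure expLaw := by
  constructor
  rw [← lintegral_one, lintegral_expLaw measurable_const]
  simp only [mul_one]
  rw [← ofReal_integral_eq_lintegral_ofReal (integrableOn_exp_neg_Ioi 0)
    (Eventually.of_forall fun t => (Real.exp_pos _).le), integral_exp_neg_Ioi_zero]
  simp

lemma charFun_expLaw (t : ℝ) : charFun expLaw t = (1 - t * Complex.I)⁻¹ := by
  rw [charFun_apply_real, expLaw, integral_withDensity_eq_integral_toReal_smul (by fun_prop)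
    (by simp)]
  have h : ∀ x : ℝ, (ENNReal.ofReal (Real.exp (-x))).toReal • Complex.exp (t * x * Complex.I) =
      Complex.exp ((t * Complex.I - 1) * x) := by
    intro x
    rw [ENNReal.toReal_ofReal (Real.exp_pos _).le, Complex.real_smul, Complex.ofReal_exp,
      ← Complex.exp_add]
    congr 1
    push_cast
    ring
  simp_rw [h]
  rw [integral_exp_mul_complex_Ioi (by simp)]
  simp only [Complex.ofReal_zero, mul_zero, Complex.exp_zero]
  rw [← neg_sub (1 : ℂ), neg_div_neg_eq, one_div]

/-- The integral itself is a complex square root. Its square avoids the choice of a branch, and the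
square is what `|z|² = x² + y²` requires. -/
lemma integral_cexp_sq_gaussianReal (t : ℝ) :
    (∫ x, Complex.exp (t * (x ^ 2 : ℝ) * Complex.I) ∂(gaussianReal 0 (1 / 2))) ^ 2 =
      (1 - t * Complex.I)⁻¹ := by
  have hv : ((1 / 2 : ℝ≥0)) ≠ 0 := by norm_num
  rw [integral_gaussianReal_eq_integral_smul hv]
  have h : ∀ x : ℝ, gaussianPDFReal 0 (1 / 2) x • Complex.exp (t * (x ^ 2 : ℝ) * Complex.I) =
      ((Real.sqrt Real.pi)⁻¹ : ℝ) * Complex.exp (-(1 - t * Complex.I) * x ^ 2) := by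
    intro x
    rw [gaussianPDFReal, Complex.real_smul]
    push_cast
    rw [mul_assoc, ← Complex.exp_add]
    have h2 : (Real.sqrt 2 : ℂ) ≠ 0 := by exact_mod_cast (by positivity : Real.sqrt 2 ≠ 0)
    norm_num
    field_simp
    congr 1
    ring
  simp_rw [h]
  rw [integral_const_mul, integral_gaussian_complex (by simp), mul_pow, ← Complex.cpow_nat_mul]
  have : ((Real.sqrt Real.pi : ℝ) : ℂ) ^ 2 = Real.pi := by
    rw [← Complex.ofReal_pow, Real.sq_sqrt Real.pi_pos.le]
  have hpi : (Real.pi : ℂ) ≠ 0 := by exact_mod_cast Real.pi_ne_zero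
  norm_num
  rw [this, div_eq_mul_inv, ← mul_assoc, inv_mul_cancel₀ hpi, one_mul]

/-- The squared modulus of a standard complex Gaussian variable is exponential. -/
theorem map_norm_sq_complexGaussian : complexGaussian.map (fun z => ‖z‖ ^ 2) = expLaw := by
  have hm : Measurable fun z : ℂ => ‖z‖ ^ 2 := by fun_prop
  have : IsProbabilityMeasure (complexGaussian.map fun z => ‖z‖ ^ 2) :=
    Measure.isProbabilityMeasure_map hm.aemeasurable
  refine Measure.ext_of_charFun ?_
  ext t
  rw [charFun_expLaw, charFun_apply_real, integral_map hm.aemeasurable (by fun_prop),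
    complexGaussian, integral_map_equiv]
  have h : ∀ x : ℝ × ℝ, Complex.exp (t * ((‖Complex.measurableEquivRealProd.symm x‖ ^ 2 : ℝ) : ℂ)
      * Complex.I) = Complex.exp (t * (x.1 ^ 2 : ℝ) * Complex.I) *
        Complex.exp (t * (x.2 ^ 2 : ℝ) * Complex.I) := by
    intro x
    rw [← Complex.exp_add, Complex.sq_norm, Complex.normSq_apply]
    congr 1
    simp [Complex.measurableEquivRealProd]
    ring
  simp_rw [h]
  rw [integral_prod_mul (fun x : ℝ => Complex.exp (t * (x ^ 2 : ℝ) * Complex.I))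
    (fun x : ℝ => Complex.exp (t * (x ^ 2 : ℝ) * Complex.I)), ← sq, integral_cexp_sq_gaussianReal]

lemma lintegral_norm_sq_complexGaussian {f : ℝ → ℝ≥0∞} (hf : Measurable f) :
    ∫⁻ z, f (‖z‖ ^ 2) ∂complexGaussian = ∫⁻ t in Set.Ioi 0, ENNReal.ofReal (Real.exp (-t)) * f t := by
  rw [← lintegral_expLaw hf, ← map_norm_sq_complexGaussian, lintegral_map hf (by fun_prop)]

lemma lintegral_expNeg_complexGaussian {a : ℝ} (ha : 0 ≤ a) :
    ∫⁻ z, expNeg (ENNReal.ofReal (a * ‖z‖ ^ 2)) ∂complexGaussian = ENNReal.ofReal (1 + a)⁻¹ := by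
  rw [lintegral_norm_sq_complexGaussian (f := fun t => expNeg (ENNReal.ofReal (a * t)))
    (measurable_expNeg.comp (by fun_prop))]
  have h : ∀ t ∈ Set.Ioi (0 : ℝ), ENNReal.ofReal (Real.exp (-t)) * expNeg (ENNReal.ofReal (a * t)) =
      ENNReal.ofReal (Real.exp (-(1 + a) * t)) := by
    intro t ht
    rw [expNeg_ofReal (mul_nonneg ha (le_of_lt ht)), ← ENNReal.ofReal_mul (Real.exp_pos _).le,
      ← Real.exp_add]
    congr 2
    ring
  have hneg : -(1 + a) < 0 := by linarith
  rw [setLIntegral_congr_fun measurableSet_Ioi h, ← ofReal_integral_eq_lintegral_ofReal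
    (integrableOn_exp_mul_Ioi hneg 0) (Eventually.of_forall fun t => (Real.exp_pos _).le),
    integral_exp_mul_Ioi hneg]
  congr 1
  rw [mul_zero, Real.exp_zero, neg_div_neg_eq, one_div]

lemma lintegral_pi_prod_eq_prod {ι : Type*} [Fintype ι] {E : ι → Type*}
    [∀ i, MeasurableSpace (E i)] {μ : ∀ i, Measure (E i)} [∀ i, IsProbabilityMeasure (μ i)]
    {f : ∀ i, E i → ℝ≥0∞} (hf : ∀ i, Measurable (f i)) :
    ∫⁻ z, ∏ i, f i (z i) ∂(Measure.pi μ) = ∏ i, ∫⁻ x, f i x ∂(μ i) := by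
  refine (lintegral_prod_eq_prod_lintegral_of_indepFun Finset.univ
    (fun i (z : ∀ i, E i) => f i (z i))
    (iIndepFun_pi fun i => (hf i).aemeasurable)
    fun i => (hf i).comp (measurable_pi_apply i)).trans ?_
  refine Finset.prod_congr rfl fun i _ => ?_
  exact (measurePreserving_eval μ i).lintegral_comp (hf i)

lemma lintegral_expNeg_sum_complexGaussian {K : ℕ} {a : ℝ} (ha : 0 ≤ a) :
    ∫⁻ z, expNeg (ENNReal.ofReal (a * ∑ k, ‖z k‖ ^ 2))
      ∂(Measure.pi fun _ : Fin K => complexGaussian) = ENNReal.ofReal ((1 + a)⁻¹ ^ K) := by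
  have h : ∀ z : Fin K → ℂ, expNeg (ENNReal.ofReal (a * ∑ k, ‖z k‖ ^ 2)) =
      ∏ k, expNeg (ENNReal.ofReal (a * ‖z k‖ ^ 2)) := by
    intro z
    rw [← expNeg_sum, Finset.mul_sum, ENNReal.ofReal_sum_of_nonneg fun k _ => by positivity]
  simp_rw [h]
  have hm : Measurable fun z : ℂ => expNeg (ENNReal.ofReal (a * ‖z‖ ^ 2)) :=
    measurable_expNeg.comp (by fun_prop)
  rw [lintegral_pi_prod_eq_prod (fun _ => hm)]
  rw [ENNReal.ofReal_pow (by positivity)]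
  simp [lintegral_expNeg_complexGaussian ha]

/-- The tail of the Erlang distribution. -/
def erlangTail (n : ℕ) (x : ℝ) : ℝ := Real.exp (-x) * ∑ k ∈ Finset.range n, x ^ k / (k ! : ℝ)

/-- The convolution step in the induction on the Erlang tail, after the factor `e^{-x}` has been
taken out. -/
lemma integral_sum_pow_div_factorial (n : ℕ) (x : ℝ) :
    ∫ t in (0 : ℝ)..x, ∑ k ∈ Finset.range n, (x - t) ^ k / (k ! : ℝ) =
      ∑ k ∈ Finset.range n, x ^ (k + 1) / ((k + 1)! : ℝ) := by
  rw [intervalIntegral.integral_comp_sub_left (fun t => ∑ k ∈ Finset.range n, t ^ k / (k ! : ℝ)),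
    intervalIntegral.integral_finsetSum (fun k _ => by
      exact (Continuous.intervalIntegrable (by fun_prop) _ _))]
  refine Finset.sum_congr rfl fun k _ => ?_
  rw [intervalIntegral.integral_div, integral_pow, Nat.factorial_succ]
  have : (k ! : ℝ) ≠ 0 := by positivity
  push_cast
  field_simp
  simp

/-- Induction on `n`, conditioning on the power `t` of one coordinate. If `t ≥ x` the event is
certain, with total contribution `e^{-x}`; if `t < x` the others must reach `x - t`. Strict
positivity of `x` matters at `n = 0`: for `x = 0` the event has probability one, whereas the empty
sum gives 0. -/
theorem measure_le_sum_norm_sq (n : ℕ) {x : ℝ} (hx : 0 < x) :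
    (Measure.pi fun _ : Fin n => complexGaussian) {z | x ≤ ∑ k, ‖z k‖ ^ 2} =
      ENNReal.ofReal (erlangTail n x) := by
  induction n generalizing x with
  | zero => simp [erlangTail, not_le.2 hx]
  | succ n ih =>
    have hmp := measurePreserving_piFinSuccAbove (fun _ : Fin (n + 1) => complexGaussian) 0
    have hS : MeasurableSet {p : ℂ × (Fin n → ℂ) | x ≤ ‖p.1‖ ^ 2 + ∑ k, ‖p.2 k‖ ^ 2} :=
      measurableSet_le measurable_const (by fun_prop)
    have hset : {z : Fin (n + 1) → ℂ | x ≤ ∑ k, ‖z k‖ ^ 2} =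
        MeasurableEquiv.piFinSuccAbove (fun _ : Fin (n + 1) => ℂ) 0 ⁻¹'
          {p : ℂ × (Fin n → ℂ) | x ≤ ‖p.1‖ ^ 2 + ∑ k, ‖p.2 k‖ ^ 2} := by
      ext z
      simp [Fin.sum_univ_succ, MeasurableEquiv.piFinSuccAbove, Fin.tail]
    rw [hset, hmp.measure_preimage hS.nullMeasurableSet, Measure.prod_apply hS]
    have hsec : ∀ z : ℂ, Prod.mk z ⁻¹' {p : ℂ × (Fin n → ℂ) | x ≤ ‖p.1‖ ^ 2 + ∑ k, ‖p.2 k‖ ^ 2} =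
        {y : Fin n → ℂ | x ≤ ‖z‖ ^ 2 + ∑ k, ‖y k‖ ^ 2} := fun z => rfl
    simp_rw [hsec]
    have hmeas : Measurable fun t : ℝ => (Measure.pi fun _ : Fin n => complexGaussian)
        {y : Fin n → ℂ | x ≤ t + ∑ k, ‖y k‖ ^ 2} := by
      refine measurable_measure_prodMk_left (s := {p : ℝ × (Fin n → ℂ) |
        x ≤ p.1 + ∑ k, ‖p.2 k‖ ^ 2}) ?_
      exact measurableSet_le measurable_const (by fun_prop)
    rw [lintegral_norm_sq_complexGaussian hmeas, ← Set.Ioo_union_Ici_eq_Ioi hx,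
      lintegral_union measurableSet_Ici (by
        rw [Set.disjoint_left]; intro t ht ht'; exact absurd ht.2 (not_lt.2 ht'))]
    have h1 : ∀ t ∈ Set.Ici x, ENNReal.ofReal (Real.exp (-t)) *
        (Measure.pi fun _ : Fin n => complexGaussian) {y : Fin n → ℂ | x ≤ t + ∑ k, ‖y k‖ ^ 2} =
        ENNReal.ofReal (Real.exp (-t)) := by
      intro t ht
      have : {y : Fin n → ℂ | x ≤ t + ∑ k, ‖y k‖ ^ 2} = Set.univ := by
        ext y
        have : 0 ≤ ∑ k, ‖y k‖ ^ 2 := by positivity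
        simp only [Set.mem_ofPred_eq, Set.mem_univ, iff_true]
        linarith [Set.mem_Ici.1 ht]
      rw [this, measure_univ, mul_one]
    have h2 : ∀ t ∈ Set.Ioo 0 x, ENNReal.ofReal (Real.exp (-t)) *
        (Measure.pi fun _ : Fin n => complexGaussian) {y : Fin n → ℂ | x ≤ t + ∑ k, ‖y k‖ ^ 2} =
        ENNReal.ofReal (Real.exp (-x) * ∑ k ∈ Finset.range n, (x - t) ^ k / (k ! : ℝ)) := by
      intro t ht
      have h3 := ih (sub_pos.2 ht.2)
      simp only [sub_le_iff_le_add'] at h3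
      rw [h3, ← ENNReal.ofReal_mul (Real.exp_pos _).le, erlangTail, ← mul_assoc, ← Real.exp_add]
      congr 4
      ring
    rw [setLIntegral_congr_fun measurableSet_Ici h1, setLIntegral_congr_fun measurableSet_Ioo h2,
      Measure.restrict_congr_set Ioi_ae_eq_Ici.symm, Measure.restrict_congr_set Ioo_ae_eq_Ioc,
      ← ofReal_integral_eq_lintegral_ofReal (integrableOn_exp_neg_Ioi x)
        (Eventually.of_forall fun t => (Real.exp_pos _).le), integral_exp_neg_Ioi,
      ← ofReal_integral_eq_lintegral_ofReal, ← ENNReal.ofReal_add]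
    · congr 1
      rw [integral_const_mul, ← intervalIntegral.integral_of_le hx.le,
        integral_sum_pow_div_factorial, erlangTail, Finset.sum_range_succ']
      simp
      ring
    · refine setIntegral_nonneg measurableSet_Ioc fun t ht => ?_
      have := sub_nonneg.2 ht.2
      positivity
    · positivity
    · exact (Continuous.integrableOn_Ioc (by fun_prop))
    · refine (ae_restrict_iff' measurableSet_Ioc).2 (Eventually.of_forall fun t ht => ?_)
      have := sub_nonneg.2 ht.2
      simp only [Pi.zero_apply]
      positivity

end

end LSMIMO

namespace LSMIMO

noncomputable section

open Filter Topology
open scoped ComplexOrder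

/-! ### Measurability of the beams -/

lemma measurable_normalize {M : ℕ} : Measurable (normalize : (Fin M → ℂ) → Fin M → ℂ) := by
  unfold normalize
  have : Measurable fun v : Fin M → ℂ => ‖WithLp.toLp 2 v‖ := by fun_prop
  exact (Complex.measurable_ofReal.comp this.inv).smul measurable_id

lemma measurable_matrix_mul {l m n : Type*} [Fintype m] {α : Type*} [MeasurableSpace α]
    {A : α → Matrix l m ℂ} {B : α → Matrix m n ℂ} (hA : ∀ i j, Measurable fun x => A x i j)
    (hB : ∀ i j, Measurable fun x => B x i j) (i : l) (j : n) :
    Measurable fun x => (A x * B x) i j := by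
  simp only [Matrix.mul_apply]
  exact Finset.measurable_sum _ fun k _ => (hA i k).mul (hB k j)

/-- The inverse is the adjugate times the inverted determinant, with the value 0 at singular
matrices. This formula is measurable everywhere. -/
lemma measurable_matrix_inv {n : Type*} [Fintype n] [DecidableEq n] {α : Type*} [MeasurableSpace α]
    {A : α → Matrix n n ℂ} (hA : ∀ i j, Measurable fun x => A x i j) (i j : n) :
    Measurable fun x => (A x)⁻¹ i j := by
  have h : Measurable fun x i j => A x i j :=
    measurable_pi_lambda _ fun i => measurable_pi_lambda _ fun j => hA i j
  have hof : Continuous fun B : n → n → ℂ => Matrix.of B := continuous_id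
  have hdet : Measurable fun B : n → n → ℂ => (Matrix.of B).det := hof.matrix_det.measurable
  have hadj : Measurable fun B : n → n → ℂ => (Matrix.of B).adjugate i j :=
    (hof.matrix_adjugate.matrix_elem i j).measurable
  simp only [Matrix.inv_def, Matrix.smul_apply, Ring.inverse_eq_inv', smul_eq_mul]
  exact ((hdet.comp h).inv).mul (hadj.comp h)

lemma measurable_zfBeam {M : ℕ} {ι : Type*} [Fintype ι] [DecidableEq ι] (i : ι) :
    Measurable fun h : ι → Fin M → ℂ => zfBeam h i := by
  have hG : ∀ a l, Measurable fun h : ι → Fin M → ℂ => otherChannels h i a l := fun a l =>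
    (measurable_pi_apply a).comp (measurable_normalize.comp (measurable_pi_apply l.1))
  have hs : Measurable fun z : ℂ => star z := continuous_star.measurable
  have hGs : ∀ l a, Measurable fun h : ι → Fin M → ℂ => (otherChannels h i)ᴴ l a := fun l a =>
    hs.comp (hG a l)
  have hpinv := fun l a => measurable_matrix_mul (fun l l' =>
    measurable_matrix_inv (fun l l' => measurable_matrix_mul hGs hG l l') l l') hGs l a
  have hQ := fun a b => (measurable_const (a := (1 : Matrix (Fin M) (Fin M) ℂ) a b)).sub
    (measurable_matrix_mul hG hpinv a b)
  refine measurable_normalize.comp (measurable_pi_lambda _ fun a => ?_)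
  simp only [Matrix.mulVec, dotProduct]
  refine Finset.measurable_sum _ fun b _ => Measurable.mul ?_ ?_
  · exact hQ a b
  · exact (measurable_pi_apply b).comp (measurable_normalize.comp (measurable_pi_apply i))

lemma measurable_power {M : ℕ} {α : Type*} [MeasurableSpace α] {f g : α → Fin M → ℂ}
    (hf : Measurable f) (hg : Measurable g) : Measurable fun x => power (f x) (g x) := by
  have hs : Measurable fun z : ℂ => star z := continuous_star.measurable
  unfold power
  simp only [dotProduct, Pi.star_apply]
  refine (Measurable.norm (Finset.measurable_sum _ fun a _ => Measurable.mul ?_ ?_)).pow_const 2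
  · exact hs.comp ((measurable_pi_apply a).comp hf)
  · exact (measurable_pi_apply a).comp hg

/-! ### Linear independence of Rayleigh vectors -/

/-- A proper subspace has a unit normal `w`. The projection of the vector on `w` is a standard
complex Gaussian, whose squared modulus is exponential and has no atom at 0. -/
lemma rayleigh_submodule {M : ℕ} {V : Submodule ℂ (Fin M → ℂ)} (hV : V ≠ ⊤) :
    rayleigh M V = 0 := by
  let e := (WithLp.linearEquiv 2 ℂ (Fin M → ℂ)).symm
  let W : Submodule ℂ (EuclideanSpace ℂ (Fin M)) := V.map e.toLinearMap
  have hW : W ≠ ⊤ := by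
    intro h
    refine hV ?_
    rw [eq_top_iff]
    intro x _
    have : e x ∈ W := by rw [h]; trivial
    obtain ⟨y, hy, hyx⟩ := this
    rwa [← e.injective hyx]
  have hWo : Wᗮ ≠ ⊥ := fun h => hW (Submodule.orthogonal_eq_bot_iff.1 h)
  obtain ⟨v, hv, hv0⟩ := Submodule.exists_mem_ne_zero_of_ne_bot hWo
  let w : Fin M → ℂ := ((‖v‖⁻¹ : ℝ) : ℂ) • v.ofLp
  have hvn : ‖v‖ ≠ 0 := norm_ne_zero_iff.2 hv0
  have hww : star w ⬝ᵥ w = 1 := by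
    have h1 : (star v.ofLp ⬝ᵥ v.ofLp : ℂ) = (‖v‖ : ℂ) ^ 2 := by
      rw [dotProduct_comm, ← EuclideanSpace.inner_eq_star_dotProduct]
      exact inner_self_eq_norm_sq_to_K v
    simp only [w, star_smul, smul_dotProduct, dotProduct_smul, smul_eq_mul, h1]
    have : (‖v‖ : ℂ) ≠ 0 := by exact_mod_cast hvn
    simp
    field_simp
  have hmap := map_rayleigh_orthonormal (ι := Unit) (fun _ => w) (by simp [hww])
  have hnull : (Measure.pi fun _ : Unit => complexGaussian) {z | z () = 0} = 0 := by
    have h0 : complexGaussian {0} = 0 := by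
      have h1 : ({0} : Set ℂ) = (fun z : ℂ => ‖z‖ ^ 2) ⁻¹' {0} := by ext z; simp
      rw [h1, ← Measure.map_apply (by fun_prop) (measurableSet_singleton _),
        map_norm_sq_complexGaussian]
      exact withDensity_absolutelyContinuous _ _ (by simp)
    have := (measurePreserving_eval (fun _ : Unit => complexGaussian) ()).measure_preimage
      (s := {0}) (measurableSet_singleton _).nullMeasurableSet
    rw [h0] at this
    exact this
  have hmeas : Measurable fun (h : Fin M → ℂ) (_ : Unit) => star h ⬝ᵥ w := by
    refine measurable_pi_lambda _ fun k => ?_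
    exact (Continuous.dotProduct continuous_star continuous_const).measurable
  have hz : MeasurableSet {z : Unit → ℂ | z () = 0} :=
    measurableSet_eq_fun (measurable_pi_apply ()) measurable_const
  rw [← hmap, Measure.map_apply hmeas hz] at hnull
  refine measure_mono_null (fun x hx => ?_) hnull
  have hxW : e x ∈ W := ⟨x, hx, rfl⟩
  have := (Submodule.mem_orthogonal W v).1 hv _ hxW
  rw [EuclideanSpace.inner_eq_star_dotProduct] at this
  change star x ⬝ᵥ w = 0
  simp only [w, dotProduct_smul]
  rw [dotProduct_comm]
  have h2 : v.ofLp ⬝ᵥ star x = 0 := this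
  rw [h2, smul_zero]

/-- Resampling one coordinate leaves a product measure invariant. -/
lemma measurePreserving_update {ι : Type*} [Fintype ι] [DecidableEq ι] {E : Type*}
    [MeasurableSpace E] (μ : Measure E) [IsProbabilityMeasure μ] (i : ι) :
    MeasurePreserving (fun p : (ι → E) × E => Function.update p.1 i p.2)
      ((Measure.pi fun _ : ι => μ).prod μ) (Measure.pi fun _ => μ) := by
  have hm : Measurable (fun p : (ι → E) × E => Function.update p.1 i p.2) := by
    refine measurable_pi_lambda _ fun j => ?_
    by_cases hj : j = i
    · subst hj; simpa using measurable_snd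
    · simp only [Function.update_of_ne hj]
      exact (measurable_pi_apply j).comp measurable_fst
  refine ⟨hm, (Measure.pi_eq fun s hs => ?_).symm⟩
  rw [Measure.map_apply hm (MeasurableSet.univ_pi hs)]
  have hset : (fun p : (ι → E) × E => Function.update p.1 i p.2) ⁻¹' Set.univ.pi s =
      (Set.univ.pi fun j => if j = i then Set.univ else s j) ×ˢ s i := by
    ext ⟨x, y⟩
    simp only [Set.mem_preimage, Set.mem_pi, Set.mem_univ, true_imp_iff, Set.mem_prod]
    constructor
    · intro h
      refine ⟨fun j => ?_, by simpa using h i⟩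
      by_cases hj : j = i
      · simp [hj]
      · simpa [hj] using h j
    · rintro ⟨h1, h2⟩ j
      by_cases hj : j = i
      · subst hj; simpa using h2
      · simpa [hj] using h1 j
  rw [hset, Measure.prod_prod, Measure.pi_pi, ← Finset.prod_erase_mul _ _ (Finset.mem_univ i),
    ← Finset.prod_erase_mul _ _ (Finset.mem_univ i)]
  simp only [if_true, measure_univ, mul_one]
  congr 1
  exact Finset.prod_congr rfl fun j hj => by rw [if_neg (Finset.ne_of_mem_erase hj)]

/-- Add one vector at a time: resampling coordinate `a` makes it independent of the earlier vectors,
and their span, having fewer than `M` generators, is a proper subspace and so a null set. -/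
lemma ae_linearIndepOn {M : ℕ} {ι : Type*} [Fintype ι] [DecidableEq ι] (s : Finset ι)
    (hs : s.card ≤ M) :
    ∀ᵐ h ∂(Measure.pi fun _ : ι => rayleigh M), LinearIndepOn ℂ h (s : Set ι) := by
  induction s using Finset.induction_on with
  | empty => simp
  | insert a s ha ih =>
    rw [Finset.card_insert_of_notMem ha] at hs
    have hopen : MeasurableSet {h : ι → Fin M → ℂ | LinearIndepOn ℂ h (insert a s : Finset ι)} := by
      have h1 : IsOpen {g : ↥(insert a s) → Fin M → ℂ | LinearIndependent ℂ g} :=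
        isOpen_setOfPred_linearIndependent
      have h2 : Continuous fun (h : ι → Fin M → ℂ) (l : (insert a s : Finset ι)) => h l := by
        fun_prop
      have h3 := h1.preimage h2
      exact h3.measurableSet
    have hmp := measurePreserving_update (ι := ι) (rayleigh M) a
    rw [← hmp.map_eq, ae_map_iff hmp.measurable.aemeasurable hopen]
    refine (Measure.ae_prod_iff_ae_ae (hmp.measurable hopen)).2 ?_
    filter_upwards [ih (by lia)] with h hh
    have hspan : Submodule.span ℂ (h '' s) ≠ ⊤ := by
      intro htop
      have h1 := finrank_span_finset_le_card (R := ℂ) (s.image h)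
      rw [Finset.coe_image, Set.finrank, htop, finrank_top, Module.finrank_fin_fun] at h1
      have := Finset.card_image_le (s := s) (f := h)
      lia
    have hnull := rayleigh_submodule hspan
    filter_upwards [measure_eq_zero_iff_ae_notMem.1 hnull] with y hy
    rw [Finset.coe_insert, linearIndepOn_insert (by simpa using ha)]
    have hne : ∀ l ∈ (s : Set ι), Function.update h a y l = h l := fun l hl =>
      Function.update_of_ne (by rintro rfl; exact ha hl) _ _
    refine ⟨(linearIndepOn_congr hne).2 hh, ?_⟩
    rw [Function.update_self, Set.image_congr hne]
    exact hy

/-! ### Zero-forcing -/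

/-- The power of the zero-forcing beam is the squared norm of the projection of the channel on the
orthogonal complement of the other channels. -/
theorem exists_power_zfBeam {M d : ℕ} {ι : Type*} [Fintype ι] [DecidableEq ι]
    (hd : d + Fintype.card ι = M + 1) (h : ι → Fin M → ℂ) (i : ι)
    (hli : LinearIndependent ℂ fun l : {l : ι // l ≠ i} => h l) :
    ∃ v : Fin d → Fin M → ℂ, (∀ k l, star (v k) ⬝ᵥ v l = if k = l then 1 else 0) ∧
      ∀ y, power y (zfBeam (Function.update h i y) i) = ∑ k, ‖star y ⬝ᵥ v k‖ ^ 2 := by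
  set G := otherChannels h i with hG
  have hGy : ∀ y, otherChannels (Function.update h i y) i = G := by
    intro y
    ext a l
    simp [hG, otherChannels, Function.update_of_ne l.2]
  have hcol : LinearIndependent ℂ G.col := by
    have hne : ∀ l : {l : ι // l ≠ i}, ((‖WithLp.toLp 2 (h l)‖⁻¹ : ℝ) : ℂ) ≠ 0 := by
      intro l
      have := hli.ne_zero l
      simpa using this
    exact hli.units_smul fun l => Units.mk0 _ (hne l)
  have hdet : IsUnit (Gᴴ * G).det := by
    rw [← Matrix.isUnit_iff_isUnit_det]
    exact (Matrix.PosDef.conjTranspose_mul_self G (Matrix.mulVec_injective_iff.2 hcol)).isUnit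
  set Q : Matrix (Fin M) (Fin M) ℂ := 1 - G * leftPinv G with hQ
  -- The range of `Q` is orthogonal to the columns of `G`, while `x - Q x` lies in their span. So
  -- `Q` is the orthogonal projection on the complement of the span.
  have hGQ : Gᴴ * Q = 0 := by
    rw [hQ, leftPinv, Matrix.mul_sub, Matrix.mul_one, ← Matrix.mul_assoc, ← Matrix.mul_assoc,
      Matrix.mul_nonsing_inv _ hdet, Matrix.one_mul, sub_self]
  let E := EuclideanSpace ℂ (Fin M)
  let e := (WithLp.linearEquiv 2 ℂ (Fin M → ℂ)).symm
  let S : Submodule ℂ E := Submodule.span ℂ (Set.range fun l => e (G.col l))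
  have hS : Module.finrank ℂ Sᗮ = d := by
    have h1 : LinearIndependent ℂ fun l => e (G.col l) :=
      hcol.map' e.toLinearMap (LinearEquiv.ker _)
    have h2 : Module.finrank ℂ S = Fintype.card {l : ι // l ≠ i} := finrank_span_eq_card h1
    have h3 := Submodule.finrank_add_finrank_orthogonal S
    rw [h2, Fintype.card_subtype_compl, Fintype.card_subtype_eq, finrank_euclideanSpace_fin] at h3
    have : 0 < Fintype.card ι := Fintype.card_pos_iff.2 ⟨i⟩
    lia
  let b : OrthonormalBasis (Fin d) ℂ Sᗮ := (stdOrthonormalBasis ℂ Sᗮ).reindex (finCongr hS)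
  have hinner : ∀ x y : Fin M → ℂ, inner ℂ (e x) (e y) = star x ⬝ᵥ y := fun x y => by
    rw [dotProduct_comm]; exact EuclideanSpace.inner_eq_star_dotProduct _ _
  refine ⟨fun k => (b k : E).ofLp, fun k l => ?_, fun y => ?_⟩
  · rw [← hinner]
    exact (orthonormal_iff_ite.1 b.orthonormal) k l
  · have hmem : ∀ x, e (Q *ᵥ x) ∈ Sᗮ := by
      intro x
      rw [Submodule.mem_orthogonal]
      intro u hu
      induction hu using Submodule.span_induction with
      | mem u hu =>
        obtain ⟨l, rfl⟩ := hu
        rw [hinner]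
        have : (Gᴴ *ᵥ (Q *ᵥ x)) l = 0 := by rw [Matrix.mulVec_mulVec, hGQ]; simp
        exact this
      | zero => simp
      | add u v _ _ hu hv => rw [inner_add_left, hu, hv, add_zero]
      | smul c u _ hu => rw [inner_smul_left, hu, mul_zero]
    have hsub : ∀ x, e x - e (Q *ᵥ x) ∈ S := by
      intro x
      have : x - Q *ᵥ x = G *ᵥ (leftPinv G *ᵥ x) := by
        rw [hQ, Matrix.sub_mulVec, Matrix.one_mulVec, sub_sub_cancel, Matrix.mulVec_mulVec]
      rw [← map_sub, this, Matrix.mulVec_eq_sum, map_sum]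
      refine Submodule.sum_mem _ fun l _ => ?_
      rw [op_smul_eq_smul, map_smul]
      exact Submodule.smul_mem _ _ (Submodule.subset_span ⟨l, rfl⟩)
    have hperp : ∀ u ∈ Sᗮ, inner ℂ (e y) u = inner ℂ (e (Q *ᵥ y)) u := by
      intro u hu
      have := (Submodule.mem_orthogonal S u).1 hu _ (hsub y)
      rw [inner_sub_left, sub_eq_zero] at this
      exact this
    set q : E := e (Q *ᵥ y) with hq
    have hsum : ∑ k, ‖star y ⬝ᵥ (b k : E).ofLp‖ ^ 2 = ‖q‖ ^ 2 := by
      have h1 := b.sum_sq_norm_inner_left ⟨q, hmem y⟩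
      rw [Submodule.coe_norm] at h1
      rw [← h1]
      refine Finset.sum_congr rfl fun k _ => ?_
      rw [← hinner]
      congr 2
      exact hperp _ (b k).2
    -- The normalization of `y` enters only as a scalar, which the outer normalization cancels in
    -- modulus. If `y` or `q` vanishes, both powers are 0.
    obtain ⟨c, hc, hc0⟩ : ∃ c : ℝ, normalize y = (c : ℂ) • y ∧ (y ≠ 0 → c ≠ 0) :=
      ⟨‖WithLp.toLp 2 y‖⁻¹, rfl, fun h => by simpa using h⟩
    have hyq : inner ℂ (e y) q = (‖q‖ : ℂ) ^ 2 := by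
      rw [hperp q (hmem y)]
      exact inner_self_eq_norm_sq_to_K _
    rw [hsum, zfBeam, hGy, Function.update_self, ← hQ, hc, Matrix.mulVec_smul, power, normalize,
      dotProduct_smul, dotProduct_smul, ← hinner]
    have hnorm : ‖WithLp.toLp 2 ((c : ℂ) • Q *ᵥ y)‖ = ‖c‖ * ‖q‖ := by
      rw [← Complex.norm_real, ← norm_smul]
      rfl
    rw [hnorm]
    rw [show inner ℂ (e y) (e (Q *ᵥ y)) = (‖q‖ : ℂ) ^ 2 from hyq]
    by_cases hy : y = 0
    · simp [hq, hy]
    · have := hc0 hy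
      by_cases hq0 : ‖q‖ = 0
      · simp [hq0]
      · simp only [smul_eq_mul, norm_mul, norm_pow, Complex.norm_real, norm_norm, norm_inv,
          norm_mul]
        have h3 : ‖c‖ ≠ 0 := by simpa using this
        field_simp
        exact congrArg (· ^ 2) (norm_norm q)

/-- The tail of the received signal power with zero-forcing beams. -/
theorem measure_le_power_zfBeam {M d : ℕ} {ι : Type*} [Fintype ι] [DecidableEq ι]
    (hd : d + Fintype.card ι = M + 1) (i : ι) {x : ℝ} (hx : 0 < x) :
    (Measure.pi fun _ : ι => rayleigh M) {h | x ≤ power (h i) (zfBeam h i)} =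
      ENNReal.ofReal (erlangTail d x) := by
  -- Resampling the channel of user `i` leaves the law unchanged and makes that channel independent
  -- of the orthonormal basis built from the others.
  have hmp := measurePreserving_update (ι := ι) (rayleigh M) i
  have hS : MeasurableSet {h : ι → Fin M → ℂ | x ≤ power (h i) (zfBeam h i)} :=
    measurableSet_le measurable_const (measurable_power (measurable_pi_apply i)
      (measurable_zfBeam i))
  rw [← hmp.measure_preimage hS.nullMeasurableSet, Measure.prod_apply (hmp.measurable hS)]
  have hae : ∀ᵐ h ∂(Measure.pi fun _ : ι => rayleigh M), rayleigh M (Prod.mk h ⁻¹'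
      ((fun p : (ι → Fin M → ℂ) × (Fin M → ℂ) => Function.update p.1 i p.2) ⁻¹'
        {h | x ≤ power (h i) (zfBeam h i)})) = ENNReal.ofReal (erlangTail d x) := by
    filter_upwards [ae_linearIndepOn (M := M) (Finset.univ.erase i) (by
      rw [Finset.card_erase_of_mem (Finset.mem_univ i), Finset.card_univ]; lia)] with h hh
    have hli : LinearIndependent ℂ fun l : {l : ι // l ≠ i} => h l := by
      have : ((Finset.univ.erase i : Finset ι) : Set ι) = {l | l ≠ i} := by ext; simp
      rw [this] at hh
      exact hh
    obtain ⟨v, hv, hpow⟩ := exists_power_zfBeam hd h i hli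
    have hset : Prod.mk h ⁻¹' ((fun p : (ι → Fin M → ℂ) × (Fin M → ℂ) =>
        Function.update p.1 i p.2) ⁻¹' {h | x ≤ power (h i) (zfBeam h i)}) =
        (fun y k => star y ⬝ᵥ v k) ⁻¹' {z : Fin d → ℂ | x ≤ ∑ k, ‖z k‖ ^ 2} := by
      ext y
      simp only [Set.mem_preimage, Set.mem_ofPred_eq, Function.update_self, hpow]
    have hmeas : Measurable fun (y : Fin M → ℂ) k => star y ⬝ᵥ v k :=
      measurable_pi_lambda _ fun k =>
        (Continuous.dotProduct continuous_star continuous_const).measurable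
    rw [hset, ← Measure.map_apply hmeas (measurableSet_le measurable_const (by fun_prop)),
      map_rayleigh_orthonormal v hv, measure_le_sum_norm_sq d hx]
  rw [lintegral_congr_ae hae]
  simp

end

end LSMIMO

namespace LSMIMO

noncomputable section

open Filter Topology

/-! ### Alzer's inequality -/

lemma integral_exp_neg_mul_unit {u : ℝ} (hu : 0 < u) :
    ∫ t in (0 : ℝ)..1, Real.exp (-(u * t)) = (1 - Real.exp (-u)) / u := by
  have h : ∀ t ∈ Set.uIcc (0 : ℝ) 1,
      HasDerivAt (fun t => -Real.exp (-(u * t)) / u) (Real.exp (-(u * t))) t := by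
    intro t _
    have h1 : HasDerivAt (fun t => Real.exp (-(u * t))) (Real.exp (-(u * t)) * -u) t := by
      simpa using ((hasDerivAt_id t).const_mul u).neg.exp
    convert! h1.neg.div_const u using 1
    field_simp
  rw [intervalIntegral.integral_eq_sub_of_hasDerivAt h
    (Continuous.intervalIntegrable (by fun_prop) _ _)]
  simp
  ring

/-- Jensen's inequality for `x ↦ x^p`: the base on the left is the mean of `e^{-ut}` over the unit
interval. -/
lemma rpow_one_sub_exp_neg_div_le {u p : ℝ} (hu : 0 < u) (hp : 1 ≤ p) :
    ((1 - Real.exp (-u)) / u) ^ p ≤ (1 - Real.exp (-(p * u))) / (p * u) := by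
  rw [← integral_exp_neg_mul_unit hu, ← integral_exp_neg_mul_unit (by positivity),
    intervalIntegral.integral_of_le zero_le_one, intervalIntegral.integral_of_le zero_le_one]
  have : IsProbabilityMeasure (volume.restrict (Set.Ioc (0 : ℝ) 1)) := ⟨by simp⟩
  have h := (convexOn_rpow hp).map_integral_le (μ := volume.restrict (Set.Ioc (0 : ℝ) 1))
    (f := fun t => Real.exp (-(u * t)))
    (Real.continuous_rpow_const (by positivity)).continuousOn isClosed_Ici
    (Eventually.of_forall fun t => (Real.exp_pos _).le)
    (Continuous.integrableOn_Ioc (by fun_prop))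
    (Continuous.integrableOn_Ioc (by
      exact (Real.continuous_rpow_const (by positivity)).comp (by fun_prop)))
  refine h.trans_eq (integral_congr_ae (Eventually.of_forall fun t => ?_))
  beta_reduce
  rw [← Real.exp_mul]
  congr 1
  ring

/-- Differentiating the product with `e^{-x}` telescopes; only minus the Erlang density survives. -/
lemma hasDerivAt_erlangTail (m : ℕ) (x : ℝ) :
    HasDerivAt (erlangTail (m + 1)) (-(Real.exp (-x) * (x ^ m / (m ! : ℝ)))) x := by
  have hexp : HasDerivAt (fun x : ℝ => Real.exp (-x)) (-Real.exp (-x)) x := by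
    simpa using (hasDerivAt_neg x).exp
  induction m with
  | zero =>
    have h : erlangTail 1 = fun x => Real.exp (-x) := by ext x; simp [erlangTail]
    rw [zero_add, h]
    simpa using hexp
  | succ m ih =>
    have h : erlangTail (m + 1 + 1) = fun x => erlangTail (m + 1) x +
        Real.exp (-x) * (x ^ (m + 1) / ((m + 1)! : ℝ)) := by
      ext x
      rw [erlangTail, Finset.sum_range_succ, mul_add]
      rfl
    rw [h]
    have h2 := ih.add (hexp.mul ((hasDerivAt_pow (m + 1) x).div_const ((m + 1)! : ℝ)))
    convert! h2 using 1
    have : (m ! : ℝ) ≠ 0 := by positivity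
    rw [Nat.factorial_succ]
    push_cast
    field_simp
    simp

lemma tendsto_erlangTail (n : ℕ) : Tendsto (erlangTail n) atTop (𝓝 0) := by
  have h : erlangTail n = fun x => ∑ k ∈ Finset.range n, x ^ k * Real.exp (-x) / (k ! : ℝ) := by
    ext x
    rw [erlangTail, Finset.mul_sum]
    exact Finset.sum_congr rfl fun k _ => by ring
  rw [h]
  have := tendsto_finsetSum (Finset.range n) fun k _ =>
    (Real.tendsto_pow_mul_exp_neg_atTop_nhds_zero k).div_const (k ! : ℝ)
  simpa using this

/-- Alzer's lower bound for the incomplete Gamma function, with integral parameter. -/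
theorem erlangTail_le {n : ℕ} (hn : 1 ≤ n) {x : ℝ} (hx : 0 ≤ x) :
    erlangTail n x ≤ 1 - (1 - Real.exp (-((n ! : ℝ) ^ (-1 / (n : ℝ)) * x))) ^ n := by
  obtain ⟨m, rfl⟩ : ∃ m, n = m + 1 := ⟨n - 1, by lia⟩
  set c : ℝ := ((m + 1)! : ℝ) ^ (-1 / ((m + 1 : ℕ) : ℝ)) with hc
  have hfac : (0 : ℝ) < ((m + 1)! : ℝ) := by positivity
  have hc0 : 0 < c := Real.rpow_pos_of_pos hfac _
  have hcpow : c ^ (m + 1) * ((m + 1)! : ℝ) = 1 := by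
    rw [hc, ← Real.rpow_natCast, ← Real.rpow_mul hfac.le, div_mul_cancel₀ _ (by positivity),
      Real.rpow_neg_one, inv_mul_cancel₀ hfac.ne']
  have hmfac : 1 / (m ! : ℝ) = (m + 1) * c ^ (m + 1) := by
    have h0 : (m ! : ℝ) ≠ 0 := by positivity
    rw [Nat.factorial_succ] at hcpow
    push_cast at hcpow
    field_simp
    linarith
  -- `f` is the gap to be shown nonnegative. The choice `c^(m+1) (m+1)! = 1` makes the constants of
  -- both derivatives match, whence `f' = (m+1) c g`.
  let f : ℝ → ℝ := fun x => 1 - (1 - Real.exp (-(c * x))) ^ (m + 1) - erlangTail (m + 1) x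
  let g : ℝ → ℝ := fun x => (c * x) ^ m * Real.exp (-x) -
    Real.exp (-(c * x)) * (1 - Real.exp (-(c * x))) ^ m
  have hf : ∀ x, HasDerivAt f ((m + 1) * c * g x) x := by
    intro x
    have h1 : HasDerivAt (fun x : ℝ => Real.exp (-(c * x))) (Real.exp (-(c * x)) * -c) x := by
      simpa using ((hasDerivAt_id x).const_mul c).neg.exp
    have h2 := (((h1.const_sub 1).pow (m + 1)).const_sub 1).sub (hasDerivAt_erlangTail m x)
    convert! h2 using 1
    have h3 : x ^ m / (m ! : ℝ) = (m + 1) * c ^ (m + 1) * x ^ m := by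
      rw [← hmfac]; ring
    rw [h3]
    simp only [g, mul_pow]
    push_cast
    ring
  -- Once negative, `g` stays negative: raise the equivalent inequality `key` at `ξ` to the power `y
  -- / ξ ≥ 1` and apply Jensen to its right-hand side.
  have hg : ∀ ξ y, 0 < ξ → ξ ≤ y → g ξ < 0 → g y < 0 := by
    intro ξ y hξ hy hgξ
    have hy0 : 0 < y := hξ.trans_le hy
    have key : ∀ x, 0 < x →
        (g x < 0 ↔ Real.exp (c * x - x) < ((1 - Real.exp (-(c * x))) / (c * x)) ^ m) := by
      intro x hx
      have h1 : 0 < (c * x) ^ m := by positivity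
      rw [div_pow, lt_div_iff₀ h1, sub_neg, sub_eq_add_neg (c * x), Real.exp_add,
        show Real.exp (-(c * x)) * (1 - Real.exp (-(c * x))) ^ m =
          (1 - Real.exp (-(c * x))) ^ m / Real.exp (c * x) by
            rw [div_eq_mul_inv, ← Real.exp_neg, mul_comm], lt_div_iff₀ (Real.exp_pos _)]
      ring_nf
    rw [key y hy0]
    have h1 := (key ξ hξ).1 hgξ
    have hp : 1 ≤ y / ξ := (one_le_div hξ).2 hy
    have hp0 : 0 < y / ξ := by linarith
    have hcξ : 0 < c * ξ := by positivity
    have hq : 0 < (1 - Real.exp (-(c * ξ))) / (c * ξ) :=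
      div_pos (sub_pos.2 (Real.exp_lt_one_iff.2 (by linarith))) hcξ
    have h2 := Real.rpow_lt_rpow (Real.exp_pos _).le h1 hp0
    have h3 := rpow_one_sub_exp_neg_div_le hcξ hp
    have h4 : y / ξ * (c * ξ) = c * y := by field_simp
    have h5 : (c * ξ - ξ) * (y / ξ) = c * y - y := by field_simp
    rw [h4] at h3
    rw [← Real.exp_mul, h5, ← Real.rpow_natCast, ← Real.rpow_mul hq.le,
      mul_comm (m : ℝ), Real.rpow_mul hq.le, Real.rpow_natCast] at h2
    exact h2.trans_le (pow_le_pow_left₀ (Real.rpow_nonneg hq.le _) h3 m)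
  have hf0 : f 0 = 0 := by simp [f, erlangTail, Finset.sum_range_succ']
  have hlim : Tendsto f atTop (𝓝 0) := by
    have h1 : Tendsto (fun x => Real.exp (-(c * x))) atTop (𝓝 0) :=
      Real.tendsto_exp_neg_atTop_nhds_zero.comp (tendsto_id.const_mul_atTop hc0)
    have h2 := (((h1.const_sub 1).pow (m + 1)).const_sub 1).sub (tendsto_erlangTail (m + 1))
    simpa using h2
  suffices 0 ≤ f x by simp only [f] at this; linarith
  -- If `f x < 0`, the mean value theorem on `[0, x]` gives `ξ < x` with `g ξ < 0`. Then `f`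
  -- decreases beyond `ξ` and stays at or below `f x`, which contradicts the limit 0.
  by_contra! hneg
  have hx0 : 0 < x := lt_of_le_of_ne hx (by rintro rfl; exact absurd hneg (by rw [hf0]; simp))
  obtain ⟨ξ, hξ, hslope⟩ := exists_hasDerivAt_eq_slope f _ hx0
    (fun y _ => (hf y).continuousAt.continuousWithinAt) fun y _ => hf y
  have hpos : 0 < (m + 1) * c := by positivity
  have hgξ : g ξ < 0 := by
    have : (m + 1) * c * g ξ < 0 := by
      rw [hslope, hf0]
      exact div_neg_of_neg_of_pos (by linarith) (by linarith)
    exact neg_of_mul_neg_right this hpos.le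
  have hanti : AntitoneOn f (Set.Ici ξ) := by
    refine antitoneOn_of_hasDerivWithinAt_nonpos (convex_Ici ξ)
      (fun y _ => (hf y).continuousAt.continuousWithinAt)
      (fun y _ => (hf y).hasDerivWithinAt) fun y hy => ?_
    rw [interior_Ici] at hy
    exact (mul_neg_of_pos_of_neg hpos (hg ξ y hξ.1 (le_of_lt hy) hgξ)).le
  have hle : ∀ᶠ y in atTop, f y ≤ f x := by
    filter_upwards [eventually_ge_atTop x] with y hy
    exact hanti (le_of_lt hξ.2) (hξ.2.le.trans hy) hy
  exact absurd (le_of_tendsto hlim hle) (not_le.2 hneg)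

/-! ### The hypergeometric function -/

lemma one_sub_mul_ne_zero {z : ℂ} (hz : z ∈ cutPlane) {x : ℝ} (hx : x ∈ Set.Icc (0 : ℝ) 1) :
    1 - z * x ≠ 0 := by
  intro h
  have h1 : z * x = 1 := (sub_eq_zero.1 h).symm
  have hx0 : x ≠ 0 := by rintro rfl; simp at h1
  have hre : z.re * x = 1 := by simpa using congrArg Complex.re h1
  have him : z.im * x = 0 := by simpa using congrArg Complex.im h1
  refine hz ⟨(mul_eq_zero.1 him).resolve_right hx0, ?_⟩
  have hx1 : 0 < x := lt_of_le_of_ne hx.1 (Ne.symm hx0)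
  nlinarith [hx.2]

/-- Compactness of the unit interval gives a locally uniform bound away from the pole; it dominates
the derivative under the integral sign. -/
lemma exists_ball_le_norm_one_sub_mul {z₀ : ℂ} (hz : z₀ ∈ cutPlane) :
    ∃ δ > 0, ∀ z ∈ Metric.ball z₀ δ, ∀ x ∈ Set.Icc (0 : ℝ) 1, δ ≤ ‖1 - z * x‖ := by
  obtain ⟨x₀, hx₀, hmin⟩ := (isCompact_Icc (a := (0 : ℝ)) (b := 1)).exists_isMinOn
    ⟨0, by simp⟩ (f := fun x : ℝ => ‖1 - z₀ * x‖) (by fun_prop)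
  have hpos : 0 < ‖1 - z₀ * x₀‖ := norm_pos_iff.2 (one_sub_mul_ne_zero hz hx₀)
  refine ⟨‖1 - z₀ * x₀‖ / 2, by positivity, fun z hzb x hx => ?_⟩
  have h1 : ‖1 - z₀ * x₀‖ ≤ ‖1 - z₀ * x‖ := hmin hx
  have h2 : ‖(z - z₀) * x‖ ≤ ‖1 - z₀ * x₀‖ / 2 := by
    rw [norm_mul, Complex.norm_real, Real.norm_of_nonneg hx.1]
    have := (mem_ball_iff_norm.1 hzb).le
    nlinarith [hx.2, norm_nonneg (z - z₀)]
  have h3 : ‖1 - z₀ * x‖ ≤ ‖1 - z * x‖ + ‖(z - z₀) * x‖ := by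
    have : 1 - z₀ * x = (1 - z * x) + (z - z₀) * x := by ring
    rw [this]
    exact norm_add_le _ _
  linarith

/-- Euler's integral, in the form needed for `₂F₁(K, -b; 1 - b; z)`. -/
def eulerIntegral (K : ℕ) (b : ℝ) (z : ℂ) : ℂ :=
  ∫ x in Set.Ioo (0 : ℝ) 1, ((x ^ (-b) : ℝ) : ℂ) * ∑ i ∈ Finset.range K, ((1 - z * x) ^ (i + 1))⁻¹

lemma integrableOn_rpow_neg {b : ℝ} (hb : b < 1) :
    IntegrableOn (fun x : ℝ => x ^ (-b)) (Set.Ioo 0 1) := by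
  have := (intervalIntegral.intervalIntegrable_rpow' (a := 0) (b := 1)
    (by linarith : -1 < -b)).1
  exact this.mono_set Set.Ioo_subset_Ioc_self

lemma differentiableOn_eulerIntegral (K : ℕ) {b : ℝ} (hb : b < 1) :
    DifferentiableOn ℂ (eulerIntegral K b) cutPlane := by
  intro z₀ hz₀
  obtain ⟨δ, hδ, hball⟩ := exists_ball_le_norm_one_sub_mul hz₀
  have hIcc : ∀ x ∈ Set.Ioo (0 : ℝ) 1, x ∈ Set.Icc (0 : ℝ) 1 := fun x hx => Set.Ioo_subset_Icc_self hx
  have hmeas : ∀ z : ℂ, AEStronglyMeasurable (fun x : ℝ => ((x ^ (-b) : ℝ) : ℂ) *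
      ∑ i ∈ Finset.range K, ((1 - z * x) ^ (i + 1))⁻¹) (volume.restrict (Set.Ioo (0 : ℝ) 1)) :=
    fun z => Measurable.aestronglyMeasurable (by fun_prop)
  have h := hasDerivAt_integral_of_dominated_loc_of_deriv_le
    (μ := volume.restrict (Set.Ioo (0 : ℝ) 1)) (x₀ := z₀) (s := Metric.ball z₀ δ)
    (F := fun (z : ℂ) (x : ℝ) => ((x ^ (-b) : ℝ) : ℂ) * ∑ i ∈ Finset.range K, ((1 - z * x) ^ (i + 1))⁻¹)
    (F' := fun (z : ℂ) (x : ℝ) => ((x ^ (-b) : ℝ) : ℂ) * ∑ i ∈ Finset.range K,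
      ((i + 1 : ℕ) * x * ((1 - z * x) ^ (i + 2))⁻¹))
    (bound := fun x => x ^ (-b) * ∑ i ∈ Finset.range K, ((i + 1 : ℕ) * (δ ^ (i + 2))⁻¹))
    (Metric.ball_mem_nhds _ hδ) (Eventually.of_forall hmeas) ?_
    (Measurable.aestronglyMeasurable (by fun_prop)) ?_ ?_ ?_
  · exact h.2.differentiableAt.differentiableWithinAt
  · refine Integrable.mono' ((integrableOn_rpow_neg hb).mul_const
      (∑ i ∈ Finset.range K, (δ ^ (i + 1))⁻¹)) (hmeas z₀) ?_
    filter_upwards [ae_restrict_mem measurableSet_Ioo] with x hx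
    rw [norm_mul, Complex.norm_real, Real.norm_of_nonneg (Real.rpow_nonneg hx.1.le _)]
    refine mul_le_mul_of_nonneg_left ?_ (Real.rpow_nonneg hx.1.le _)
    refine norm_sum_le_of_le _ fun i _ => ?_
    rw [norm_inv, norm_pow]
    have := hball z₀ (Metric.mem_ball_self hδ) x (hIcc x hx)
    gcongr
  · filter_upwards [ae_restrict_mem measurableSet_Ioo] with x hx z hz
    rw [norm_mul, Complex.norm_real, Real.norm_of_nonneg (Real.rpow_nonneg hx.1.le _)]
    refine mul_le_mul_of_nonneg_left ?_ (Real.rpow_nonneg hx.1.le _)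
    refine norm_sum_le_of_le _ fun i _ => ?_
    rw [norm_mul, norm_mul, norm_inv, norm_pow, Complex.norm_natCast, Complex.norm_real,
      Real.norm_of_nonneg hx.1.le]
    have := hball z hz x (hIcc x hx)
    refine mul_le_mul ?_ (by gcongr) (by positivity) (by positivity)
    exact mul_le_of_le_one_right (by positivity) hx.2.le
  · exact (integrableOn_rpow_neg hb).mul_const _
  · filter_upwards [ae_restrict_mem measurableSet_Ioo] with x hx z hz
    have hne : 1 - z * x ≠ 0 := norm_pos_iff.1 (hδ.trans_le (hball z hz x (hIcc x hx)))
    refine HasDerivAt.const_mul _ (HasDerivAt.fun_sum fun i _ => ?_)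
    have h1 : HasDerivAt (fun z : ℂ => 1 - z * x) (-(x : ℂ)) z := by
      simpa using ((hasDerivAt_id z).mul_const (x : ℂ)).const_sub 1
    have h2 := (h1.fun_pow (i + 1)).fun_inv (pow_ne_zero _ hne)
    convert! h2 using 1
    push_cast
    generalize 1 - z * (x : ℂ) = q at hne
    field_simp
    ring

/-- The hockey-stick identity, which collects the negative binomial series of the `K` terms in
Euler's integral. -/
lemma sum_range_choose_add (K n : ℕ) :
    ∑ i ∈ Finset.range K, (n + i).choose i = (n + K).choose (n + 1) := by
  induction K with
  | zero => simp
  | succ K ih =>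
    rw [Finset.sum_range_succ, ih, ← add_assoc, Nat.choose_succ_succ, add_comm]
    congr 1
    rw [← Nat.choose_symm_add]

/-- Inside the disc, expand the inverse powers in negative binomial series and integrate term by
term, using `∫₀¹ x^(n-b) dx = 1 / (n + 1 - b)`. The integrals of the norms are summable because `‖z‖
< 1`. -/
lemma hasSum_eulerIntegral (K : ℕ) {b : ℝ} (hb : b < 1) {z : ℂ} (hz : ‖z‖ < 1) :
    HasSum (fun n : ℕ => ((n + K).choose (n + 1) : ℂ) * z ^ n / ((n : ℂ) + 1 - b))
      (eulerIntegral K b z) := by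
  have hint : ∀ n : ℕ, ∫ x in Set.Ioo (0 : ℝ) 1, x ^ (-b) * x ^ n = 1 / ((n : ℝ) + 1 - b) := by
    intro n
    rw [← integral_Ioc_eq_integral_Ioo, ← intervalIntegral.integral_of_le zero_le_one]
    have h1 : ∀ x ∈ Set.uIoc (0 : ℝ) 1, x ^ (-b) * x ^ n = x ^ ((n : ℝ) - b) := by
      intro x hx
      rw [Set.uIoc_of_le zero_le_one] at hx
      rw [← Real.rpow_natCast, ← Real.rpow_add hx.1]
      congr 1
      ring
    rw [intervalIntegral.integral_congr_ae (Eventually.of_forall h1), integral_rpow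
      (Or.inl (by have : (0 : ℝ) ≤ n := by positivity
                  linarith))]
    have h2 : (n : ℝ) - b + 1 ≠ 0 := by
      have : (0 : ℝ) ≤ n := by positivity
      linarith
    rw [Real.one_rpow, Real.zero_rpow h2, sub_zero]
    congr 1
    ring
  have hintble : ∀ n : ℕ, IntegrableOn (fun x : ℝ => x ^ (-b) * x ^ n) (Set.Ioo 0 1) := by
    intro n
    refine Integrable.mono' (integrableOn_rpow_neg hb) (Measurable.aestronglyMeasurable
      (by fun_prop)) ?_
    filter_upwards [ae_restrict_mem measurableSet_Ioo] with x hx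
    rw [Real.norm_of_nonneg (mul_nonneg (Real.rpow_nonneg hx.1.le _) (by have := hx.1; positivity))]
    exact mul_le_of_le_one_right (Real.rpow_nonneg hx.1.le _) (pow_le_one₀ hx.1.le hx.2.le)
  let F : ℕ → ℝ → ℂ := fun n x => (((n + K).choose (n + 1) : ℂ) * z ^ n) * ((x ^ (-b) * x ^ n : ℝ) : ℂ)
  have hFint : ∀ n, IntegrableOn (F n) (Set.Ioo 0 1) := fun n => (hintble n).ofReal.const_mul _
  have hchoose : ∀ (w : ℂ), ‖w‖ < 1 → HasSum (fun n : ℕ => ((n + K).choose (n + 1) : ℂ) * w ^ n)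
      (∑ i ∈ Finset.range K, ((1 - w) ^ (i + 1))⁻¹) := by
    intro w hw
    have := hasSum_sum fun i (_ : i ∈ Finset.range K) =>
      hasSum_choose_mul_geometric_of_norm_lt_one i hw
    simp only [one_div] at this
    convert! this using 2 with n
    rw [← Finset.sum_mul, ← sum_range_choose_add]
    push_cast
    rfl
  have hnorm : ∀ n, ∫ x in Set.Ioo (0 : ℝ) 1, ‖F n x‖ =
      ((n + K).choose (n + 1) : ℝ) * ‖z‖ ^ n * (1 / ((n : ℝ) + 1 - b)) := by
    intro n
    rw [← hint n, ← integral_const_mul]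
    refine setIntegral_congr_fun measurableSet_Ioo fun x hx => ?_
    have : 0 ≤ x ^ (-b) * x ^ n :=
      mul_nonneg (Real.rpow_nonneg hx.1.le _) (by have := hx.1; positivity)
    simp only [F]
    rw [norm_mul, norm_mul, norm_pow, Complex.norm_natCast, Complex.norm_real,
      Real.norm_of_nonneg this]
  have hsum : Summable fun n => ∫ x in Set.Ioo (0 : ℝ) 1, ‖F n x‖ := by
    simp_rw [hnorm]
    have h1 : Summable fun n : ℕ => ((n + K).choose (n + 1) : ℝ) * ‖z‖ ^ n := by
      have := (hchoose (‖z‖ : ℂ) (by simpa using hz)).summable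
      exact_mod_cast this
    refine Summable.of_nonneg_of_le (fun n => ?_) (fun n => ?_) (h1.mul_right (1 / (1 - b)))
    · have : (0 : ℝ) ≤ n := by positivity
      have : 0 < (n : ℝ) + 1 - b := by linarith
      positivity
    · have h0 : (0 : ℝ) ≤ n := by positivity
      have : 0 < 1 - b := by linarith
      gcongr
      linarith
  have h := hasSum_integral_of_summable_integral_norm hFint hsum
  have hval : ∀ n, ∫ x in Set.Ioo (0 : ℝ) 1, F n x =
      ((n + K).choose (n + 1) : ℂ) * z ^ n / ((n : ℂ) + 1 - b) := by
    intro n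
    simp only [F]
    rw [integral_const_mul, integral_complex_ofReal, hint n]
    push_cast
    ring
  simp_rw [hval] at h
  convert! h using 1
  refine setIntegral_congr_fun measurableSet_Ioo fun x hx => ?_
  have hzx : ‖z * x‖ < 1 := by
    rw [norm_mul, Complex.norm_real, Real.norm_of_nonneg hx.1.le]
    nlinarith [hx.1, hx.2, norm_nonneg z]
  rw [← (hchoose _ hzx).tsum_eq, ← tsum_mul_left]
  refine tsum_congr fun n => ?_
  simp only [F]
  push_cast
  ring

lemma ascPochhammer_eval_ofReal_ne_zero {c : ℝ} (hc : 0 < c) (n : ℕ) :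
    (ascPochhammer ℂ n).eval (c : ℂ) ≠ 0 := by
  induction n with
  | zero => simp
  | succ n ih =>
    rw [ascPochhammer_succ_eval]
    refine mul_ne_zero ih ?_
    have : c + n ≠ 0 := by positivity
    exact_mod_cast this

lemma ascPochhammer_eval_natCast {K : ℕ} (hK : 1 ≤ K) (n : ℕ) :
    (ascPochhammer ℂ n).eval (K : ℂ) = (n ! : ℂ) * ((n + K - 1).choose n : ℂ) := by
  obtain ⟨k, rfl⟩ : ∃ k, K = k + 1 := ⟨K - 1, by lia⟩
  rw [← ascPochhammer_eval_cast, ascPochhammer_nat_eq_ascFactorial,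
    Nat.ascFactorial_eq_factorial_mul_choose, show n + (k + 1) - 1 = k + n by lia, Nat.cast_mul]

/-- The lower parameter exceeds `-b` by one, so the quotient of the two Pochhammer symbols
telescopes to `-b / (n + 1 - b)`. -/
lemma hypergeometric_coeff_succ {K : ℕ} (hK : 1 ≤ K) {b : ℝ} (hb : b < 1) (z : ℂ) (n : ℕ) :
    (((n + 1)! : ℂ)⁻¹ * (ascPochhammer ℂ (n + 1)).eval (K : ℂ) *
      (ascPochhammer ℂ (n + 1)).eval ((-b : ℝ) : ℂ) *
      ((ascPochhammer ℂ (n + 1)).eval ((1 - b : ℝ) : ℂ))⁻¹) • z ^ (n + 1) =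
      -(b * z) * (((n + K).choose (n + 1) : ℂ) * z ^ n / ((n : ℂ) + 1 - b)) := by
  have hb1 : (ascPochhammer ℂ (n + 1)).eval ((-b : ℝ) : ℂ) =
      -b * (ascPochhammer ℂ n).eval ((1 - b : ℝ) : ℂ) := by
    rw [ascPochhammer_succ_left, Polynomial.eval_mul, Polynomial.eval_X, Polynomial.eval_comp]
    simp only [Polynomial.eval_add, Polynomial.eval_X, Polynomial.eval_one]
    rw [show ((-b : ℝ) : ℂ) + 1 = ((1 - b : ℝ) : ℂ) by push_cast; ring, Complex.ofReal_neg]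
  have hb2 : (ascPochhammer ℂ n).eval ((1 - b : ℝ) : ℂ) ≠ 0 :=
    ascPochhammer_eval_ofReal_ne_zero (by linarith) n
  have hb3 : (n : ℂ) + 1 - b ≠ 0 := by
    have : (n : ℝ) + 1 - b ≠ 0 := by
      have : (0 : ℝ) ≤ n := by positivity
      linarith
    exact_mod_cast this
  have hfac : ((n + 1)! : ℂ) ≠ 0 := by exact_mod_cast (Nat.factorial_pos _).ne'
  have hc : ((1 - b : ℝ) : ℂ) + n = (n : ℂ) + 1 - b := by push_cast; ring
  rw [ascPochhammer_eval_natCast hK, hb1, ascPochhammer_succ_eval, smul_eq_mul, hc, pow_succ,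
    show n + 1 + K - 1 = n + K by lia]
  generalize (ascPochhammer ℂ n).eval ((1 - b : ℝ) : ℂ) = q at *
  generalize ((n + 1)! : ℂ) = f at *
  generalize ((n + K).choose (n + 1) : ℂ) = g at *
  field_simp

lemma isPrincipalBranch_euler {K : ℕ} (hK : 1 ≤ K) {b : ℝ} (hb : b < 1) :
    IsPrincipalBranch (K : ℂ) ((-b : ℝ) : ℂ) ((1 - b : ℝ) : ℂ)
      (fun z => 1 - b * z * eulerIntegral K b z) := by
  refine ⟨?_, fun z hz => ?_⟩
  · have := differentiableOn_eulerIntegral K hb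
    fun_prop
  have hz' : ‖z‖ < 1 := by simpa using hz
  rw [ordinaryHypergeometric_eq_tsum]
  have hs := (hasSum_eulerIntegral K hb hz').mul_left (-(b * z))
  simp_rw [← hypergeometric_coeff_succ hK hb] at hs
  have hs' := ((hasSum_nat_add_iff (f := fun n : ℕ => ((n ! : ℂ)⁻¹ *
    (ascPochhammer ℂ n).eval (K : ℂ) * (ascPochhammer ℂ n).eval ((-b : ℝ) : ℂ) *
    ((ascPochhammer ℂ n).eval ((1 - b : ℝ) : ℂ))⁻¹) • z ^ n) 1).1 hs).tsum_eq
  refine Eq.trans ?_ hs'.symm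
  rw [Finset.sum_range_one, ascPochhammer_zero, pow_zero]
  simp only [Polynomial.eval_one, Nat.factorial_zero, Nat.cast_one, inv_one, mul_one, one_smul]
  ring

lemma isOpen_cutPlane : IsOpen cutPlane := by
  have : cutPlane = ({z : ℂ | z.im = 0} ∩ {z | 1 ≤ z.re})ᶜ := rfl
  rw [this, isOpen_compl_iff]
  exact (isClosed_eq Complex.continuous_im continuous_const).inter
    (isClosed_le continuous_const Complex.continuous_re)

lemma starConvex_cutPlane : StarConvex ℝ 0 cutPlane := by
  intro z hz a t ha ht hat h
  simp only [smul_zero, zero_add, Complex.real_smul, Complex.mul_im, Complex.ofReal_re,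
    Complex.ofReal_im, zero_mul, add_zero, Complex.mul_re, sub_zero] at h
  have ht0 : t ≠ 0 := by rintro rfl; norm_num at h
  refine hz ⟨(mul_eq_zero.1 h.1).resolve_left ht0, ?_⟩
  have : 0 < t := lt_of_le_of_ne ht ht0.symm
  nlinarith [h.2]

lemma IsPrincipalBranch.eqOn {a b c : ℂ} {f g : ℂ → ℂ} (hf : IsPrincipalBranch a b c f)
    (hg : IsPrincipalBranch a b c g) : Set.EqOn f g cutPlane := by
  have h0 : (0 : ℂ) ∈ cutPlane := by simp [cutPlane]
  refine (hf.1.analyticOnNhd isOpen_cutPlane).eqOn_of_preconnected_of_eventuallyEq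
    (hg.1.analyticOnNhd isOpen_cutPlane)
    (starConvex_cutPlane.isPathConnected h0).isConnected.isPreconnected h0 ?_
  filter_upwards [Metric.ball_mem_nhds (0 : ℂ) one_pos] with z hz
  rw [hf.2 z hz, hg.2 z hz]

/-- The function chosen in `hyp2F1` is known only through its defining property. Uniqueness on the
connected cut plane identifies it with the Euler representation. -/
theorem hyp2F1_eq {K : ℕ} (hK : 1 ≤ K) {b : ℝ} (hb : b < 1) {z : ℂ}
    (hz : z ∈ cutPlane) :
    hyp2F1 (K : ℂ) ((-b : ℝ) : ℂ) ((1 - b : ℝ) : ℂ) z = 1 - b * z * eulerIntegral K b z := by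
  have hex : ∃ f, IsPrincipalBranch (K : ℂ) ((-b : ℝ) : ℂ) ((1 - b : ℝ) : ℂ) f :=
    ⟨_, isPrincipalBranch_euler hK hb⟩
  rw [hyp2F1, dif_pos hex]
  exact hex.choose_spec.eqOn (isPrincipalBranch_euler hK hb) hz

/-- A finite geometric sum. It converts the integrand of `eulerIntegral` at negative argument into
the form `1 - (1 + w)^{-K}` that the Laplace functional produces. -/
lemma mul_sum_inv_pow (K : ℕ) {w : ℝ} (hw : 0 ≤ w) :
    w * ∑ i ∈ Finset.range K, ((1 + w) ^ (i + 1))⁻¹ = 1 - ((1 + w) ^ K)⁻¹ := by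
  induction K with
  | zero => simp
  | succ K ih =>
    rw [Finset.sum_range_succ, mul_add, ih]
    have : 1 + w ≠ 0 := by positivity
    field_simp
    ring

lemma rpow_mul_one_sub_eq (K : ℕ) {b y x : ℝ} (hy : 0 ≤ y) (hx : x ∈ Set.Ioo (0 : ℝ) 1) :
    x ^ (-b - 1) * (1 - ((1 + y * x) ^ K)⁻¹) =
      y * (x ^ (-b) * ∑ i ∈ Finset.range K, ((1 + y * x) ^ (i + 1))⁻¹) := by
  have hx0 := hx.1
  rw [← mul_sum_inv_pow K (by positivity), Real.rpow_sub_one hx0.ne']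
  field_simp

lemma integrableOn_rpow_mul_one_sub (K : ℕ) {b y : ℝ} (hb : b < 1) (hy : 0 ≤ y) :
    IntegrableOn (fun x : ℝ => x ^ (-b - 1) * (1 - ((1 + y * x) ^ K)⁻¹)) (Set.Ioo 0 1) := by
  refine Integrable.mono' ((integrableOn_rpow_neg hb).mul_const (y * K))
    (Measurable.aestronglyMeasurable (by fun_prop)) ?_
  filter_upwards [ae_restrict_mem measurableSet_Ioo] with x hx
  have hx0 := hx.1
  rw [rpow_mul_one_sub_eq K hy hx, Real.norm_of_nonneg (by positivity), mul_left_comm]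
  refine mul_le_mul_of_nonneg_left (mul_le_mul_of_nonneg_left ?_ hy) (by positivity)
  calc ∑ i ∈ Finset.range K, ((1 + y * x) ^ (i + 1))⁻¹ ≤ ∑ i ∈ Finset.range K, (1 : ℝ) :=
        Finset.sum_le_sum fun i _ => inv_le_one_of_one_le₀
          (one_le_pow₀ (by nlinarith [mul_nonneg hy hx0.le]))
    _ = K := by simp

lemma one_sub_hyp2F1 {K : ℕ} (hK : 1 ≤ K) {b y : ℝ} (hb : b < 1) (hy : 0 ≤ y) :
    1 - (hyp2F1 (K : ℂ) ((-b : ℝ) : ℂ) ((1 - b : ℝ) : ℂ) ((-y : ℝ) : ℂ)).re =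
      -(b * ∫ x in Set.Ioo (0 : ℝ) 1, x ^ (-b - 1) * (1 - ((1 + y * x) ^ K)⁻¹)) := by
  have hz : ((-y : ℝ) : ℂ) ∈ cutPlane := by
    rintro ⟨_, h⟩
    rw [Complex.ofReal_re] at h
    linarith
  have hE : eulerIntegral K b ((-y : ℝ) : ℂ) = ((∫ x in Set.Ioo (0 : ℝ) 1,
      x ^ (-b) * ∑ i ∈ Finset.range K, ((1 + y * x) ^ (i + 1))⁻¹ : ℝ) : ℂ) := by
    rw [eulerIntegral, ← integral_complex_ofReal]
    refine integral_congr_ae (Eventually.of_forall fun x => ?_)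
    push_cast
    simp only [neg_mul, sub_neg_eq_add]
  rw [hyp2F1_eq hK hb hz, hE, setIntegral_congr_fun measurableSet_Ioo
    (fun x hx => rpow_mul_one_sub_eq K (b := b) hy hx), integral_const_mul, ← Complex.ofReal_mul,
    ← Complex.ofReal_mul, Complex.sub_re, Complex.ofReal_re, Complex.one_re]
  ring

/-! ### The radial integral in closed form -/

section radial

variable {p : Params}

lemma Params.Valid.one_add_div_pos (hp : p.Valid) : 0 < 1 + p.Rc / p.d0 := by
  have := hp.Rc_pos
  have := hp.d0_pos
  positivity

/-- The radial integral of the interference, in closed form. -/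
theorem radial_integral (hp : p.Valid) {K : ℕ} (hK : 1 ≤ K) {s : ℝ} (hs : 0 ≤ s) :
    IntegrableOn (fun v => v * (1 - ((1 + s * p.rho * p.pathLoss v) ^ K)⁻¹)) (Set.Ioi p.Rc) ∧
      ∫ v in Set.Ioi p.Rc, v * (1 - ((1 + s * p.rho * p.pathLoss v) ^ K)⁻¹) =
        p.PsiII K s - p.PsiI K s := by
  have hα : 0 < p.alpha := by linarith [hp.alpha_gt]
  have hd := hp.d0_pos
  have hρ := hp.rho_pos
  set t₀ := 1 + p.Rc / p.d0 with ht₀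
  have ht : 0 < t₀ := hp.one_add_div_pos
  set a := 1 / p.alpha with ha
  have ha0 : 0 < a := by positivity
  have haα : a * p.alpha = 1 := by rw [ha]; field_simp
  set y := s * p.rho * t₀ ^ (-p.alpha) with hy
  have hy0 : 0 ≤ y := by positivity
  -- The new variable `x` is the path loss at distance `v` relative to that at the cluster edge:
  -- solving `1 + v / d₀ = t₀ x^(-1/α)` for `v` gives `pos x`, and maps `(0, 1)` onto `(R_c, ∞)`.
  let pos : ℝ → ℝ := fun x => p.d0 * (t₀ * x ^ (-a) - 1)
  let dpos : ℝ → ℝ := fun x => p.d0 * (t₀ * (-a * x ^ (-a - 1)))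
  have hRc : p.Rc = p.d0 * (t₀ - 1) := by rw [ht₀]; field_simp; ring
  have hderiv : ∀ x ∈ Set.Ioo (0 : ℝ) 1, HasDerivWithinAt pos (dpos x) (Set.Ioo 0 1) x := by
    intro x hx
    exact ((((Real.hasDerivAt_rpow_const (Or.inl hx.1.ne')).const_mul t₀).sub_const 1).const_mul
      p.d0).hasDerivWithinAt
  have hinj : Set.InjOn pos (Set.Ioo 0 1) := by
    intro x hx x' hx' h
    have h1 : x ^ (-a) = x' ^ (-a) := by
      have h2 := mul_left_cancel₀ hd.ne' h
      exact mul_left_cancel₀ ht.ne' (sub_left_inj.1 h2)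
    exact (Real.rpow_left_inj hx.1.le hx'.1.le (by linarith)).1 h1
  have himage : pos '' Set.Ioo 0 1 = Set.Ioi p.Rc := by
    ext v
    constructor
    · rintro ⟨x, hx, rfl⟩
      have h1 : 1 < x ^ (-a) := Real.one_lt_rpow_of_pos_of_lt_one_of_neg hx.1 hx.2 (by linarith)
      rw [Set.mem_Ioi, hRc]
      have := mul_lt_mul_of_pos_left h1 ht
      exact mul_lt_mul_of_pos_left (by linarith) hd
    · intro hv
      have hv1 : t₀ < 1 + v / p.d0 := by
        have := div_lt_div_of_pos_right (Set.mem_Ioi.1 hv) hd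
        linarith
      have hq : 1 < (1 + v / p.d0) / t₀ := (one_lt_div ht).2 hv1
      refine ⟨((1 + v / p.d0) / t₀) ^ (-p.alpha), ⟨by positivity,
        Real.rpow_lt_one_of_one_lt_of_neg hq (by linarith)⟩, ?_⟩
      simp only [pos]
      rw [← Real.rpow_mul (by positivity), neg_mul_neg, mul_comm p.alpha, haα, Real.rpow_one]
      field_simp
      ring
  have hloss : ∀ x ∈ Set.Ioo (0 : ℝ) 1, s * p.rho * p.pathLoss (pos x) = y * x := by
    intro x hx
    have h1 : 1 + pos x / p.d0 = t₀ * x ^ (-a) := by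
      simp only [pos]
      field_simp
      ring
    rw [Params.pathLoss, h1, Real.mul_rpow ht.le (Real.rpow_nonneg hx.1.le _),
      ← Real.rpow_mul hx.1.le, neg_mul_neg, haα, Real.rpow_one, hy]
    ring
  -- The factor `v = d₀ t₀ x^(-a) - d₀` splits the integrand: its first term yields the exponent
  -- `2/α` of `Ψ_I`, its second the exponent `1/α` of `Ψ_II`.
  have hint : ∀ x ∈ Set.Ioo (0 : ℝ) 1,
      |dpos x| • (pos x * (1 - ((1 + s * p.rho * p.pathLoss (pos x)) ^ K)⁻¹)) =
        p.d0 ^ 2 * t₀ ^ 2 * a * (x ^ (-(2 / p.alpha) - 1) * (1 - ((1 + y * x) ^ K)⁻¹)) -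
        p.d0 ^ 2 * t₀ * a * (x ^ (-(1 / p.alpha) - 1) * (1 - ((1 + y * x) ^ K)⁻¹)) := by
    intro x hx
    have h1 : |dpos x| = p.d0 * (t₀ * (a * x ^ (-a - 1))) := by
      have h2 : dpos x = -(p.d0 * (t₀ * (a * x ^ (-a - 1)))) := by simp only [dpos]; ring
      have h3 := Real.rpow_nonneg hx.1.le (-a - 1)
      rw [h2, abs_neg, abs_of_nonneg (by positivity)]
    have h4 : x ^ (-(2 / p.alpha) - 1) = x ^ (-a - 1) * x ^ (-a) := by
      rw [← Real.rpow_add hx.1]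
      congr 1
      rw [ha]
      ring
    rw [h1, hloss x hx, h4, smul_eq_mul, ← ha]
    simp only [pos]
    ring
  have hb2 : 2 / p.alpha < 1 := (div_lt_one hα).2 hp.alpha_gt
  have hb1 : 1 / p.alpha < 1 := (div_lt_one hα).2 (by linarith [hp.alpha_gt])
  have hI2 := (integrableOn_rpow_mul_one_sub K hb2 hy0).const_mul (p.d0 ^ 2 * t₀ ^ 2 * a)
  have hI1 := (integrableOn_rpow_mul_one_sub K hb1 hy0).const_mul (p.d0 ^ 2 * t₀ * a)
  rw [← himage]
  constructor
  · rw [integrableOn_image_iff_integrableOn_abs_deriv_smul measurableSet_Ioo hderiv hinj,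
      integrableOn_congr_fun hint measurableSet_Ioo]
    exact hI2.sub hI1
  · rw [integral_image_eq_integral_abs_deriv_smul measurableSet_Ioo hderiv hinj,
      setIntegral_congr_fun measurableSet_Ioo hint, integral_sub hI2 hI1, integral_const_mul,
      integral_const_mul, Params.PsiI, Params.PsiII, ← ht₀, ← hy, one_sub_hyp2F1 hK hb2 hy0,
      one_sub_hyp2F1 hK hb1 hy0, ha]
    field_simp
    ring

end radial

/-! ### Independence -/

section independence

variable {Ω : Type*} [MeasurableSpace Ω] {P : Measure Ω} [IsProbabilityMeasure P]
  {E F G : Type*} [MeasurableSpace E] [MeasurableSpace F] [MeasurableSpace G]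
  {X : Ω → E} {Y : Ω → F} {Z : Ω → G}

/-- The hypotheses make the joint law a product of three factors, which may be regrouped; this
isolates the one variable to be averaged first. -/
lemma indepFun_prodMk_of_indepFun (hX : AEMeasurable X P) (hY : AEMeasurable Y P)
    (hZ : AEMeasurable Z P) (h1 : IndepFun X (fun ω => (Y ω, Z ω)) P) (h2 : IndepFun Y Z P) :
    IndepFun Y (fun ω => (X ω, Z ω)) P := by
  have := Measure.isProbabilityMeasure_map hX
  have := Measure.isProbabilityMeasure_map hY
  have := Measure.isProbabilityMeasure_map hZ
  have hYZ := (indepFun_iff_map_prod_eq_prod_map_map hY hZ).1 h2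
  have hXYZ := (indepFun_iff_map_prod_eq_prod_map_map hX (hY.prodMk hZ)).1 h1
  have hXZ' : IndepFun X Z P := h1.comp measurable_id measurable_snd
  have hXZ := (indepFun_iff_map_prod_eq_prod_map_map hX hZ).1 hXZ'
  rw [indepFun_iff_map_prod_eq_prod_map_map hY (hX.prodMk hZ), hXZ]
  let f : E × F × G → F × E × G := fun p => (p.2.1, p.1, p.2.2)
  have hf : Measurable f := by fun_prop
  have hmap : (P.map fun ω => (Y ω, X ω, Z ω)) = (P.map fun ω => (X ω, Y ω, Z ω)).map f :=
    (AEMeasurable.map_map_of_aemeasurable hf.aemeasurable (hX.prodMk (hY.prodMk hZ))).symm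
  have h3 := measurePreserving_prodAssoc (P.map Y) (P.map X) (P.map Z)
  have h4 := ((Measure.measurePreserving_swap (μ := P.map X) (ν := P.map Y)).prod
    (MeasurePreserving.id (P.map Z)))
  have h5 := (measurePreserving_prodAssoc (P.map X) (P.map Y) (P.map Z)).symm
  rw [hmap, hXYZ, hYZ]
  exact (h3.comp (h4.comp h5)).map_eq

lemma lintegral_of_indepFun (hX : AEMeasurable X P) (hY : AEMeasurable Y P)
    (h : IndepFun X Y P) {Φ : E × F → ℝ≥0∞} (hΦ : Measurable Φ) :
    ∫⁻ ω, Φ (X ω, Y ω) ∂P = ∫⁻ ω, ∫⁻ x, Φ (x, Y ω) ∂(P.map X) ∂P := by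
  have := Measure.isProbabilityMeasure_map hX
  have := Measure.isProbabilityMeasure_map hY
  rw [← lintegral_map' (f := Φ) hΦ.aemeasurable (hX.prodMk hY),
    (indepFun_iff_map_prod_eq_prod_map_map hX hY).1 h, lintegral_prod_symm _ hΦ.aemeasurable,
    lintegral_map' (f := fun y => ∫⁻ x, Φ (x, y) ∂(P.map X)) hΦ.lintegral_prod_left'.aemeasurable hY]

lemma measure_of_indepFun (hX : AEMeasurable X P) (hY : AEMeasurable Y P)
    (h : IndepFun X Y P) {S : Set (E × F)} (hS : MeasurableSet S) :
    P {ω | (X ω, Y ω) ∈ S} = ∫⁻ ω, P.map X {x | (x, Y ω) ∈ S} ∂P := by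
  have := Measure.isProbabilityMeasure_map hX
  have := Measure.isProbabilityMeasure_map hY
  have h1 := Measure.map_apply_of_aemeasurable (hX.prodMk hY) hS
  rw [(indepFun_iff_map_prod_eq_prod_map_map hX hY).1 h, Measure.prod_apply_symm hS,
    lintegral_map' (measurable_measure_prodMk_right hS).aemeasurable hY] at h1
  exact h1.symm

end independence

/-! ### The Laplace transform of the interference -/

/-- Writing the factor of one interferer as an exponential turns the product over interferers into a
sum over points, the shape required by `IsPoissonProcess.laplace`. -/
lemma expNeg_log_one_add {a : ℝ} (ha : 0 ≤ a) (K : ℕ) :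
    expNeg (ENNReal.ofReal (K * Real.log (1 + a))) = ENNReal.ofReal ((1 + a)⁻¹ ^ K) := by
  have h0 : 0 < 1 + a := by positivity
  rw [expNeg_ofReal (mul_nonneg (Nat.cast_nonneg _) (Real.log_nonneg (by linarith)))]
  congr 1
  rw [← mul_neg, Real.exp_nat_mul, Real.exp_neg, Real.exp_log h0]

lemma lintegral_expNeg_power {M K : ℕ} {w : Fin K → Fin M → ℂ}
    (hw : ∀ k l, star (w k) ⬝ᵥ w l = if k = l then 1 else 0) {a : ℝ} (ha : 0 ≤ a) :
    ∫⁻ h, expNeg (ENNReal.ofReal (∑ k, a * power h (w k))) ∂(rayleigh M) =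
      expNeg (ENNReal.ofReal (K * Real.log (1 + a))) := by
  have hmeas : Measurable fun (h : Fin M → ℂ) k => star h ⬝ᵥ w k :=
    measurable_pi_lambda _ fun k =>
      (Continuous.dotProduct continuous_star continuous_const).measurable
  rw [expNeg_log_one_add ha, ← lintegral_expNeg_sum_complexGaussian ha,
    ← map_rayleigh_orthonormal w hw, lintegral_map (f := fun z : Fin K → ℂ =>
      expNeg (ENNReal.ofReal (a * ∑ k, ‖z k‖ ^ 2))) (measurable_expNeg.comp (by fun_prop)) hmeas]
  simp only [power, Finset.mul_sum]

/-- Independence factors the finite partial sums; dominated convergence with bound 1 passes to the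
infinite sum, finite or not. -/
lemma lintegral_expNeg_tsum_infinitePi {E : Type*} [MeasurableSpace E] {μ : Measure E}
    [IsProbabilityMeasure μ] {g : ℕ → E → ℝ≥0∞} (hg : ∀ m, Measurable (g m)) {c : ℕ → ℝ≥0∞}
    (hc : ∀ m, ∫⁻ h, expNeg (g m h) ∂μ = expNeg (c m)) :
    ∫⁻ h, expNeg (∑' m, g m (h m)) ∂(Measure.infinitePi fun _ : ℕ => μ) = expNeg (∑' m, c m) := by
  have hgm : ∀ m, Measurable fun h : ℕ → E => expNeg (g m (h m)) := fun m =>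
    measurable_expNeg.comp ((hg m).comp (measurable_pi_apply m))
  have hfin : ∀ n, ∫⁻ h, expNeg (∑ m ∈ Finset.range n, g m (h m))
      ∂(Measure.infinitePi fun _ : ℕ => μ) = expNeg (∑ m ∈ Finset.range n, c m) := by
    intro n
    simp_rw [expNeg_sum]
    refine (lintegral_prod_eq_prod_lintegral_of_indepFun (Finset.range n)
      (fun m (h : ℕ → E) => expNeg (g m (h m)))
      (iIndepFun_infinitePi (X := fun m x => expNeg (g m x))
        fun m => measurable_expNeg.comp (hg m)) hgm).trans ?_
    refine Finset.prod_congr rfl fun m _ => ?_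
    rw [← hc m]
    exact (measurePreserving_eval_infinitePi (fun _ : ℕ => μ) m).lintegral_comp
      (measurable_expNeg.comp (hg m))
  have h1 : Tendsto (fun n => ∫⁻ h, expNeg (∑ m ∈ Finset.range n, g m (h m))
      ∂(Measure.infinitePi fun _ : ℕ => μ)) atTop
      (𝓝 (∫⁻ h, expNeg (∑' m, g m (h m)) ∂(Measure.infinitePi fun _ : ℕ => μ))) := by
    refine tendsto_lintegral_of_dominated_convergence (fun _ => 1) (fun n => ?_)
      (fun n => Eventually.of_forall fun h => expNeg_le_one _) (by simp)
      (Eventually.of_forall fun h =>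
        (continuous_expNeg.tendsto _).comp (ENNReal.tendsto_nat_tsum _))
    simp_rw [expNeg_sum]
    exact Finset.measurable_prod _ fun m _ => hgm m
  refine tendsto_nhds_unique h1 ?_
  simp_rw [hfin]
  exact (continuous_expNeg.tendsto _).comp (ENNReal.tendsto_nat_tsum _)

section model

variable {Ω : Type*} [MeasurableSpace Ω] {M K O : ℕ} {N : Network Ω M K O}
  {P : Measure Ω} {p : Params} {u : Plane}

/-- The interference as a function of the locations, the fading and the channels that determine
the beams. -/
def interferenceFun (M K O : ℕ) (p : Params) (u : Plane)
    (y : (ℕ → Plane) × (ℕ → Fin M → ℂ) × (ℕ → Fin K ⊕ Fin O → Fin M → ℂ)) : ℝ≥0∞ :=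
  ∑' m : ℕ, ENNReal.ofReal (∑ k : Fin K, p.rho * p.pathLoss (dist (y.1 m) u) *
    power (y.2.1 m) (zfBeam (y.2.2 m) (Sum.inl k)))

lemma measurable_pathLoss (p : Params) : Measurable p.pathLoss := by
  unfold Params.pathLoss
  fun_prop

lemma measurable_interferenceFun : Measurable (interferenceFun M K O p u) := by
  refine Measurable.tsum fun m => ENNReal.measurable_ofReal.comp
    (Finset.measurable_sum _ fun k _ => Measurable.mul ?_ ?_)
  · exact ((measurable_pathLoss p).comp (((measurable_pi_apply m).comp measurable_fst).dist
      measurable_const)).const_mul _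
  · refine measurable_power ((measurable_pi_apply m).comp (measurable_fst.comp measurable_snd)) ?_
    exact (measurable_zfBeam _).comp
      ((measurable_pi_apply m).comp (measurable_snd.comp measurable_snd))

lemma Params.Valid.pathLoss_pos (hp : p.Valid) {r : ℝ} (hr : 0 ≤ r) : 0 < p.pathLoss r := by
  have := hp.d0_pos
  unfold Params.pathLoss
  positivity

/-- The integral of a radial function over the outside of a disc. -/
lemma lintegral_radial {R : ℝ} (hR : 0 < R) (u : Plane) {f : ℝ → ℝ} (hfm : Measurable f)
    (hf : ∀ v, R < v → 0 ≤ f v) (hint : IntegrableOn (fun v => v * f v) (Set.Ioi R)) :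
    ∫⁻ x in {x : Plane | R < dist x u}, ENNReal.ofReal (f (dist x u)) =
      ENNReal.ofReal (2 * Real.pi * ∫ v in Set.Ioi R, v * f v) := by
  have hmeasS : MeasurableSet {x : Plane | R < dist x u} :=
    measurableSet_lt measurable_const (by fun_prop)
  let g : ℝ → ℝ := (Set.Ioi R).indicator f
  have hg0 : ∀ v, 0 ≤ g v := fun v => Set.indicator_nonneg (fun v hv => hf v hv) v
  have hgm : Measurable g := hfm.indicator measurableSet_Ioi
  have hfin : Module.finrank ℝ Plane = 2 := finrank_euclideanSpace_fin
  have hgi : ∀ v ∈ Set.Ioi (0 : ℝ), v ^ (Module.finrank ℝ Plane - 1) • g v =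
      (Set.Ioi R).indicator (fun v => v * f v) v := by
    intro v _
    rw [hfin]
    by_cases hv : v ∈ Set.Ioi R <;> simp [g, hv, -Set.mem_Ioi]
  have hsub : Set.Ioi (0 : ℝ) ∩ Set.Ioi R = Set.Ioi R :=
    Set.inter_eq_right.2 (Set.Ioi_subset_Ioi hR.le)
  have hgint : Integrable (fun x : Plane => g ‖x‖) := by
    rw [integrable_fun_norm_addHaar, integrableOn_congr_fun hgi measurableSet_Ioi]
    exact (hint.integrable_indicator measurableSet_Ioi).integrableOn
  calc ∫⁻ x in {x : Plane | R < dist x u}, ENNReal.ofReal (f (dist x u))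
      = ∫⁻ x : Plane, ENNReal.ofReal (g ‖x - u‖) := by
        rw [← lintegral_indicator hmeasS]
        refine lintegral_congr fun x => ?_
        by_cases hx : R < dist x u
        · rw [Set.indicator_of_mem (show x ∈ {x : Plane | R < dist x u} from hx), ← dist_eq_norm]
          simp only [g]
          rw [Set.indicator_of_mem (Set.mem_Ioi.2 hx)]
        · rw [Set.indicator_of_notMem (show x ∉ {x : Plane | R < dist x u} from hx),
            ← dist_eq_norm]
          simp only [g]
          rw [Set.indicator_of_notMem (show dist x u ∉ Set.Ioi R from hx), ENNReal.ofReal_zero]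
    _ = ∫⁻ x : Plane, ENNReal.ofReal (g ‖x‖) :=
        lintegral_sub_right_eq_self (fun x : Plane => ENNReal.ofReal (g ‖x‖)) u
    _ = ENNReal.ofReal (∫ x : Plane, g ‖x‖) :=
        (ofReal_integral_eq_lintegral_ofReal hgint (Eventually.of_forall fun x => hg0 _)).symm
    _ = _ := by
        rw [integral_fun_norm_addHaar, setIntegral_congr_fun measurableSet_Ioi hgi,
          setIntegral_indicator measurableSet_Ioi, hsub, hfin, Measure.real,
          EuclideanSpace.volume_ball_fin_two]
        congr 1
        simp [Real.pi_pos.le]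
        ring

/-- Average over the cross fading, then over the locations of the interferers, and evaluate the
resulting intensity integral in polar coordinates. -/
theorem Network.Model.lintegral_expNeg_interference [IsProbabilityMeasure P] (hp : p.Valid)
    (hK : 1 ≤ K) (hN : N.Model P p u) {s : ℝ} (hs : 0 ≤ s) :
    ∫⁻ ω, expNeg (ENNReal.ofReal s * N.interference p u ω) ∂P =
      ENNReal.ofReal (Real.exp (2 * Real.pi * p.lam * (p.PsiI K s - p.PsiII K s))) := by
  have hρ := hp.rho_pos
  have hfar := hN.far_poisson.measurable
  have hother := hN.other_measurable
  have hcross := hN.cross_law.aemeasurable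
  have hind1 : IndepFun N.far (fun ω => (N.cross ω, N.other ω)) P :=
    hN.indep_location_fading.comp measurable_snd measurable_snd
  have hind := indepFun_prodMk_of_indepFun hfar.aemeasurable hcross hother.aemeasurable hind1
    hN.indep_cross_other
  have hloss : ∀ x : Plane, 0 ≤ s * p.rho * p.pathLoss (dist x u) := fun x =>
    mul_nonneg (by positivity) (hp.pathLoss_pos dist_nonneg).le
  let Φ : (ℕ → Fin M → ℂ) × (ℕ → Plane) × (ℕ → Fin K ⊕ Fin O → Fin M → ℂ) → ℝ≥0∞ := fun q =>
    expNeg (ENNReal.ofReal s * interferenceFun M K O p u (q.2.1, q.1, q.2.2))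
  have hΦ : Measurable Φ := by
    have := measurable_interferenceFun (M := M) (K := K) (O := O) (p := p) (u := u)
    exact measurable_expNeg.comp ((this.comp (by fun_prop)).const_mul _)
  let c : Plane → ℝ≥0∞ := fun x =>
    ENNReal.ofReal (K * Real.log (1 + s * p.rho * p.pathLoss (dist x u)))
  have hc : Measurable c := by
    have := measurable_pathLoss p
    fun_prop
  -- With locations and beams frozen, the average is the same for all orthonormal beams, so the law
  -- of `other` is never needed.
  have hstep : ∀ᵐ ω ∂P, ∫⁻ h, Φ (h, N.far ω, N.other ω) ∂(P.map N.cross) =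
      expNeg (∑' m, c (N.far ω m)) := by
    filter_upwards [hN.other_orthonormal] with ω hω
    rw [hN.cross_law.map_eq]
    have hterm : ∀ h : ℕ → Fin M → ℂ, Φ (h, N.far ω, N.other ω) = expNeg (∑' m, ENNReal.ofReal
        (∑ k : Fin K, s * p.rho * p.pathLoss (dist (N.far ω m) u) *
          power (h m) (zfBeam (N.other ω m) (Sum.inl k)))) := by
      intro h
      simp only [Φ, interferenceFun]
      rw [← ENNReal.tsum_mul_left]
      congr 1
      refine tsum_congr fun m => ?_
      rw [← ENNReal.ofReal_mul hs, Finset.mul_sum]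
      simp only [mul_assoc]
    simp_rw [hterm]
    refine lintegral_expNeg_tsum_infinitePi (g := fun m h => ENNReal.ofReal
      (∑ k : Fin K, s * p.rho * p.pathLoss (dist (N.far ω m) u) *
        power h (zfBeam (N.other ω m) (Sum.inl k)))) (fun m => ?_) fun m => ?_
    · exact ENNReal.measurable_ofReal.comp (Finset.measurable_sum _ fun k _ =>
        (measurable_power measurable_id measurable_const).const_mul _)
    · exact lintegral_expNeg_power (hω m) (hloss _)
  have h1 : ∫⁻ ω, expNeg (ENNReal.ofReal s * N.interference p u ω) ∂P =
      ∫⁻ ω, expNeg (∑' m, c (N.far ω m)) ∂P := by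
    rw [← lintegral_congr_ae hstep]
    exact lintegral_of_indepFun hcross (hfar.prodMk hother).aemeasurable hind hΦ
  have : SigmaFinite (ENNReal.ofReal p.lam • volume.restrict {x : Plane | p.Rc < dist x u}) := by
    rw [← withDensity_const]
    exact SigmaFinite.withDensity (fun _ => p.lam.toNNReal)
  rw [h1, hN.far_poisson.laplace hc, lintegral_smul_measure]
  have hrad := radial_integral hp hK hs
  have h2 : ∀ x : Plane, 1 - expNeg (c x) = ENNReal.ofReal
      (1 - ((1 + s * p.rho * p.pathLoss (dist x u)) ^ K)⁻¹) := by
    intro x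
    have h0 := hloss x
    simp only [c]
    rw [expNeg_log_one_add h0, ENNReal.ofReal_sub _ (by positivity), ENNReal.ofReal_one, inv_pow]
  have hpos : ∀ v, p.Rc < v → 0 ≤ 1 - ((1 + s * p.rho * p.pathLoss v) ^ K)⁻¹ := by
    intro v hv
    have h0 : 0 ≤ s * p.rho * p.pathLoss v :=
      mul_nonneg (by positivity) (hp.pathLoss_pos (hp.Rc_pos.trans hv).le).le
    exact sub_nonneg.2 (inv_le_one_of_one_le₀ (one_le_pow₀ (by linarith)))
  have hmeas : Measurable fun v => 1 - ((1 + s * p.rho * p.pathLoss v) ^ K)⁻¹ := by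
    have := measurable_pathLoss p
    fun_prop
  simp_rw [h2]
  have h3 := lintegral_radial hp.Rc_pos u hmeas hpos hrad.1
  rw [hrad.2] at h3
  have hnn : 0 ≤ p.PsiII K s - p.PsiI K s := by
    rw [← hrad.2]
    exact setIntegral_nonneg measurableSet_Ioi fun v hv =>
      mul_nonneg (hp.Rc_pos.trans hv).le (hpos v hv)
  have hlam := hp.lam_pos
  have hpi := Real.pi_pos
  rw [h3, smul_eq_mul, ← ENNReal.ofReal_mul hlam.le, expNeg_ofReal (by positivity)]
  congr 2
  ring

end model

/-! ### The distance of the serving base station -/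

section model

variable {Ω : Type*} [MeasurableSpace Ω] {M K O : ℕ} {N : Network Ω M K O}
  {P : Measure Ω} {p : Params} {u : Plane}

lemma Network.rmin_nonneg {Ω : Type*} (N : Network Ω M K O) (u : Plane) (ω : Ω) : 0 ≤ N.rmin u ω :=
  Real.iInf_nonneg fun _ => dist_nonneg

lemma measurable_iInf_dist (u : Plane) : Measurable fun x : ℕ → Plane => ⨅ m, dist (x m) u := by
  refine Measurable.iInf fun m => ?_
  exact (measurable_pi_apply m).dist measurable_const

lemma hasDerivAt_cdfNearest (p : Params) (r : ℝ) :
    HasDerivAt p.cdfNearest (2 * (p.lam * Real.pi) * (r * Real.exp (-(p.lam * Real.pi) * r ^ 2)))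
      r := by
  have h1 : HasDerivAt (fun r : ℝ => -(p.lam * Real.pi * r ^ 2)) (-(p.lam * Real.pi * (2 * r))) r := by
    convert! ((hasDerivAt_pow 2 r).const_mul (p.lam * Real.pi)).neg using 1
    simp
  convert! h1.exp.const_sub 1 using 1
  ring_nf

lemma deriv_cdfNearest (p : Params) : deriv p.cdfNearest = fun r =>
    2 * (p.lam * Real.pi) * (r * Real.exp (-(p.lam * Real.pi) * r ^ 2)) :=
  funext fun r => (hasDerivAt_cdfNearest p r).deriv

lemma measurable_deriv_cdfNearest (p : Params) : Measurable (deriv p.cdfNearest) :=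
  measurable_deriv _

lemma Params.Valid.deriv_cdfNearest_nonneg (hp : p.Valid) {r : ℝ} (hr : 0 ≤ r) :
    0 ≤ deriv p.cdfNearest r := by
  have := hp.lam_pos
  have := Real.pi_pos
  rw [deriv_cdfNearest]
  positivity

lemma Params.Valid.integrable_deriv_cdfNearest (hp : p.Valid) :
    Integrable (deriv p.cdfNearest) := by
  rw [deriv_cdfNearest]
  exact (integrable_mul_exp_neg_mul_sq (mul_pos hp.lam_pos Real.pi_pos)).const_mul _

lemma Params.Valid.integral_Ioi_deriv_cdfNearest (hp : p.Valid) (r : ℝ) :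
    ∫ t in Set.Ioi r, deriv p.cdfNearest t = 1 - p.cdfNearest r := by
  have hd : ∀ t, HasDerivAt p.cdfNearest (deriv p.cdfNearest t) t := fun t =>
    (hasDerivAt_cdfNearest p t).differentiableAt.hasDerivAt
  refine integral_Ioi_of_hasDerivAt_of_tendsto (hd r).continuousAt.continuousWithinAt
    (fun t _ => hd t) hp.integrable_deriv_cdfNearest.integrableOn ?_
  have h1 : Tendsto (fun t : ℝ => Real.exp (-(p.lam * Real.pi * t ^ 2))) atTop (𝓝 0) :=
    Real.tendsto_exp_neg_atTop_nhds_zero.comp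
      ((tendsto_pow_atTop two_ne_zero).const_mul_atTop (mul_pos hp.lam_pos Real.pi_pos))
  have h2 := h1.const_sub 1
  rw [sub_zero] at h2
  exact h2

/-- The law of the distance of the nearest point. -/
def Params.nearestLaw (p : Params) : Measure ℝ :=
  (volume.restrict (Set.Ioi 0)).withDensity fun r => ENNReal.ofReal (deriv p.cdfNearest r)

lemma Params.Valid.nearestLaw_Ici (hp : p.Valid) {r : ℝ} (hr : 0 ≤ r) :
    p.nearestLaw (Set.Ici r) = ENNReal.ofReal (1 - p.cdfNearest r) := by
  have hset : (Set.Ici r ∩ Set.Ioi 0 : Set ℝ) =ᵐ[volume] Set.Ioi r := by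
    refine (Ioi_ae_eq_Ici.symm.inter (ae_eq_refl _)).trans (Eventually.of_forall fun x => ?_)
    exact propext ⟨fun h => h.1, fun h => ⟨h, hr.trans_lt h⟩⟩
  rw [Params.nearestLaw, withDensity_apply _ measurableSet_Ici,
    Measure.restrict_restrict measurableSet_Ici, Measure.restrict_congr_set hset,
    ← hp.integral_Ioi_deriv_cdfNearest r, ofReal_integral_eq_lintegral_ofReal
      hp.integrable_deriv_cdfNearest.integrableOn]
  filter_upwards [ae_restrict_mem measurableSet_Ioi] with t ht
  exact hp.deriv_cdfNearest_nonneg (hr.trans_lt ht).le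

lemma nearestLaw_Iio (p : Params) : p.nearestLaw (Set.Iio 0) = 0 := by
  rw [Params.nearestLaw, withDensity_apply _ measurableSet_Iio,
    Measure.restrict_restrict measurableSet_Iio]
  have : (Set.Iio 0 ∩ Set.Ioi 0 : Set ℝ) = ∅ := by
    ext x
    simpa using le_of_lt
  simp [this]

/-- The nearest point is at distance at least `r` exactly when the open disc of radius `r` is empty,
which has the Poisson void probability. Neither law charges negative numbers, so the half-lines `[r,
∞)` with `r ≥ 0` decide. -/
theorem Network.Model.map_rmin [IsProbabilityMeasure P] (hp : p.Valid) (hN : N.Model P p u) :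
    P.map (N.rmin u) = p.nearestLaw := by
  have hnear := hN.near_poisson.measurable
  have hmeas : Measurable (N.rmin u) := (measurable_iInf_dist u).comp hnear
  have := Measure.isProbabilityMeasure_map (μ := P) hmeas.aemeasurable
  have hIci : ∀ r, 0 ≤ r → P.map (N.rmin u) (Set.Ici r) = p.nearestLaw (Set.Ici r) := by
    intro r hr
    have hvol : (ENNReal.ofReal p.lam • (volume : Measure Plane)) (Metric.ball u r) =
        ENNReal.ofReal (p.lam * Real.pi * r ^ 2) := by
      rw [Measure.smul_apply, EuclideanSpace.volume_ball_fin_two, smul_eq_mul,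
        ← ENNReal.ofReal_pow hr, ← ENNReal.ofReal_mul (by positivity),
        ← ENNReal.ofReal_mul hp.lam_pos.le]
      congr 1
      ring
    have hset : N.rmin u ⁻¹' Set.Ici r = {ω | count (N.near ω) (Metric.ball u r) = (0 : ℕ)} := by
      ext ω
      have hbdd : BddBelow (Set.range fun m => dist (N.near ω m) u) :=
        ⟨0, by rintro _ ⟨m, rfl⟩; exact dist_nonneg⟩
      simp only [Set.mem_preimage, Set.mem_Ici, Network.rmin, Set.mem_ofPred_eq, count,
        Nat.cast_zero, Set.encard_eq_zero, Set.eq_empty_iff_forall_notMem, Metric.mem_ball, not_lt]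
      exact le_ciInf_iff hbdd
    rw [Measure.map_apply hmeas measurableSet_Ici, hset,
      hN.near_poisson.count_law _ Metric.isOpen_ball.measurableSet (by rw [hvol]; simp) 0, hvol,
      hp.nearestLaw_Ici hr, poissonMeasure_singleton]
    have h0 : 0 ≤ p.lam * Real.pi * r ^ 2 := by
      have := hp.lam_pos
      have := Real.pi_pos
      positivity
    have h1 : ((ENNReal.ofReal (p.lam * Real.pi * r ^ 2)).toNNReal : ℝ) = p.lam * Real.pi * r ^ 2 :=
      ENNReal.toReal_ofReal h0
    congr 1
    simp [Params.cdfNearest, h1]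
  have huniv : ∀ μ : Measure ℝ, μ (Set.Iio 0) = 0 → ∀ r ≤ 0, μ (Set.Ici r) = μ (Set.Ici 0) := by
    intro μ hμ r hr
    refine le_antisymm ?_ (measure_mono (Set.Ici_subset_Ici.2 hr))
    calc μ (Set.Ici r) ≤ μ (Set.Iio 0 ∪ Set.Ici 0) :=
          measure_mono fun x _ => lt_or_ge x 0
      _ ≤ μ (Set.Iio 0) + μ (Set.Ici 0) := measure_union_le _ _
      _ = μ (Set.Ici 0) := by rw [hμ, zero_add]
  refine Measure.ext_of_Ici _ _ fun r => ?_
  rcases le_total 0 r with hr | hr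
  · exact hIci r hr
  · rw [huniv _ ?_ r hr, huniv _ (nearestLaw_Iio p) r hr, hIci 0 le_rfl]
    rw [Measure.map_apply hmeas measurableSet_Iio]
    have : N.rmin u ⁻¹' Set.Iio 0 = ∅ := by
      ext ω
      simpa using N.rmin_nonneg u ω
    simp [this]

theorem Network.Model.measure_rmin_le [IsProbabilityMeasure P] (hp : p.Valid)
    (hN : N.Model P p u) {r : ℝ} (hr : 0 < r) :
    P.real {ω | N.rmin u ω ≤ r} = p.cdfNearest r := by
  have hmeas : Measurable (N.rmin u) := (measurable_iInf_dist u).comp hN.near_poisson.measurable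
  have := Measure.isProbabilityMeasure_map (μ := P) hmeas.aemeasurable
  have h1 : P.real {ω | N.rmin u ω ≤ r} = (P.map (N.rmin u)).real (Set.Iic r) := by
    rw [map_measureReal_apply hmeas measurableSet_Iic]
    rfl
  have h2 : (P.map (N.rmin u)).real (Set.Ioi r) = 1 - p.cdfNearest r := by
    have hae : (P.map (N.rmin u)) (Set.Ioi r) = (P.map (N.rmin u)) (Set.Ici r) := by
      rw [hN.map_rmin hp]
      exact measure_congr ((withDensity_absolutelyContinuous _ _).ae_eq
        (Measure.absolutelyContinuous_of_le Measure.restrict_le_self |>.ae_eq Ioi_ae_eq_Ici))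
    have hnn : 0 ≤ 1 - p.cdfNearest r := by
      simp only [Params.cdfNearest, sub_sub_cancel]
      positivity
    rw [Measure.real, hae, hN.map_rmin hp, hp.nearestLaw_Ici hr.le, ENNReal.toReal_ofReal hnn]
  rw [h1, ← Set.compl_Ioi, probReal_compl_eq_one_sub measurableSet_Ioi, h2, sub_sub_cancel]

/-! ### The bound -/

/-- The Laplace transform of the interference plus noise. -/
def Network.laplace (N : Network Ω M K O) (P : Measure Ω) (p : Params) (u : Plane) (s : ℝ) :
    ℝ≥0∞ :=
  ∫⁻ ω, expNeg (ENNReal.ofReal s * (N.interference p u ω + 1)) ∂P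

/-- Monotonicity supplies the measurability of the Laplace transform in `s`. -/
lemma antitone_laplace : Antitone (N.laplace P p u) := fun _ _ h =>
  lintegral_mono fun _ => antitone_expNeg (mul_le_mul_left (ENNReal.ofReal_le_ofReal h) _)

lemma laplace_le_one [IsProbabilityMeasure P] (s : ℝ) : N.laplace P p u s ≤ 1 := by
  calc N.laplace P p u s ≤ ∫⁻ _, 1 ∂P := lintegral_mono fun _ => expNeg_le_one _
    _ = 1 := by simp

lemma Network.Model.laplace_eq [IsProbabilityMeasure P] (hp : p.Valid) (hK : 1 ≤ K)
    (hN : N.Model P p u) {s : ℝ} (hs : 0 ≤ s) :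
    N.laplace P p u s = ENNReal.ofReal (Real.exp (-s) *
      Real.exp (2 * Real.pi * p.lam * (p.PsiI K s - p.PsiII K s))) := by
  rw [ENNReal.ofReal_mul (Real.exp_pos _).le, ← hN.lintegral_expNeg_interference hp hK hs,
    ← expNeg_ofReal hs, Network.laplace, ← lintegral_const_mul' _ _ (expNeg_ne_top _)]
  refine lintegral_congr fun ω => ?_
  rw [mul_add, mul_one, expNeg_add, mul_comm]

lemma Params.Valid.sArg_nonneg (hp : p.Valid) {ζ : ℕ} {κ : ℝ} (hκ : 0 ≤ κ) (j : ℕ) {r : ℝ}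
    (hr : 0 ≤ r) : 0 ≤ p.sArg ζ κ j r := by
  have := hp.tau_pos
  have := hp.rho_pos
  have := hp.d0_pos
  have h1 : 0 ≤ (2 : ℝ) ^ (κ / p.w) - 1 :=
    sub_nonneg.2 (Real.one_le_rpow one_le_two (div_nonneg hκ hp.w_pos.le))
  unfold Params.sArg
  positivity

lemma measurable_sArg (p : Params) (ζ : ℕ) (κ : ℝ) (j : ℕ) : Measurable (p.sArg ζ κ j) := by
  unfold Params.sArg
  fun_prop

lemma one_sub_one_sub_pow (ζ : ℕ) (v : ℝ) :
    1 - (1 - v) ^ ζ = ∑ j ∈ Finset.Icc 1 ζ, (ζ.choose j : ℝ) * (-1) ^ (j + 1) * v ^ j := by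
  rw [sub_eq_neg_add 1 v, add_pow, Finset.range_eq_Ico, Finset.sum_eq_sum_Ico_succ_bot (by lia)]
  have : Finset.Ico (0 + 1) (ζ + 1) = Finset.Icc 1 ζ := by ext; simp
  rw [this]
  simp only [pow_zero, one_pow, mul_one, Nat.choose_zero_right, Nat.cast_one, sub_add_cancel_left]
  rw [← Finset.sum_neg_distrib]
  refine Finset.sum_congr rfl fun j _ => ?_
  rw [neg_pow v]
  ring

lemma expNeg_pow (x : ℝ≥0∞) (j : ℕ) : expNeg x ^ j = expNeg (j * x) := by
  induction j with
  | zero => simp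
  | succ j ih => rw [pow_succ, ih, ← expNeg_add]; congr 1; push_cast; ring

/-- The bound for the tail of the signal power, given the distance `r` of the serving station and
the interference `I`. -/
def Params.condBound (p : Params) (ζ : ℕ) (κ r : ℝ) (I : ℝ≥0∞) : ℝ :=
  ∑ j ∈ Finset.Icc 1 ζ, (ζ.choose j : ℝ) * (-1) ^ (j + 1) *
    (expNeg (ENNReal.ofReal (p.sArg ζ κ j r) * (I + 1))).toReal

/-- `sArg` is linear in `j`, so the exponentials are powers of the one with `j = 1`, and the sum is
a binomial expansion. -/
lemma Params.condBound_eq (p : Params) (ζ : ℕ) (κ r : ℝ) (I : ℝ≥0∞) :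
    p.condBound ζ κ r I =
      1 - (1 - (expNeg (ENNReal.ofReal (p.sArg ζ κ 1 r) * (I + 1))).toReal) ^ ζ := by
  rw [one_sub_one_sub_pow, Params.condBound]
  refine Finset.sum_congr rfl fun j _ => ?_
  rw [← ENNReal.toReal_pow, expNeg_pow]
  congr 3
  have : p.sArg ζ κ j r = j * p.sArg ζ κ 1 r := by
    unfold Params.sArg
    push_cast
    ring
  rw [this, ENNReal.ofReal_mul (Nat.cast_nonneg j), ENNReal.ofReal_natCast, mul_assoc]

lemma Params.condBound_nonneg (p : Params) (ζ : ℕ) (κ r : ℝ) (I : ℝ≥0∞) :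
    0 ≤ p.condBound ζ κ r I := by
  rw [p.condBound_eq]
  have h1 := ENNReal.toReal_mono ENNReal.one_ne_top
    (expNeg_le_one (ENNReal.ofReal (p.sArg ζ κ 1 r) * (I + 1)))
  have h2 : 0 ≤ (expNeg (ENNReal.ofReal (p.sArg ζ κ 1 r) * (I + 1))).toReal :=
    ENNReal.toReal_nonneg
  rw [ENNReal.toReal_one] at h1
  exact sub_nonneg.2 (pow_le_one₀ (by linarith) (by linarith))

/-- Dividing by the mean received power turns the event into an Erlang tail at `x`. Alzer's constant
times `x` is `sArg` at `j = 1` times `I + 1`. -/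
lemma measure_signal_le {ζ : ℕ} (hζ : 1 ≤ ζ) (hM : M + 1 = K + O + ζ) (hp : p.Valid) (i : Fin K)
    {κ : ℝ} (hκ : 0 ≤ κ) {r : ℝ} (hr : 0 ≤ r) (I : ℝ≥0∞) :
    (Measure.pi fun _ : Fin K ⊕ Fin O => rayleigh M)
      {h | ENNReal.ofReal (p.tau * ((2 : ℝ) ^ (κ / p.w) - 1)) * (I + 1) ≤ ENNReal.ofReal
        (p.rho * p.pathLoss r * power (h (Sum.inl i)) (zfBeam h (Sum.inl i)))} ≤
      ENNReal.ofReal (p.condBound ζ κ r I) := by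
  have hτ := hp.tau_pos
  have hρ := hp.rho_pos
  have hd := hp.d0_pos
  have hpl := hp.pathLoss_pos hr
  have hT : 0 ≤ (2 : ℝ) ^ (κ / p.w) - 1 :=
    sub_nonneg.2 (Real.one_le_rpow one_le_two (div_nonneg hκ hp.w_pos.le))
  rw [p.condBound_eq]
  -- At `κ = 0` the threshold vanishes and the bound is 1, since `0 ^ ζ = 0` for `ζ ≥ 1`.
  rcases hT.eq_or_lt with hT0 | hT0
  · have hs : p.sArg ζ κ 1 r = 0 := by simp [Params.sArg, ← hT0]
    rw [hs, ENNReal.ofReal_zero, zero_mul, expNeg_zero, ENNReal.toReal_one, sub_self,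
      zero_pow (by lia), sub_zero, ENNReal.ofReal_one]
    exact prob_le_one
  set c := (ζ ! : ℝ) ^ (-1 / (ζ : ℝ)) with hc
  set T := p.tau * ((2 : ℝ) ^ (κ / p.w) - 1) with hTdef
  have hTpos : 0 < T := by positivity
  have hc0 : 0 < c := by positivity
  have hs : p.sArg ζ κ 1 r = c * (T / (p.rho * p.pathLoss r)) := by
    have h1 : 0 < 1 + r / p.d0 := by positivity
    rw [Params.sArg, Params.pathLoss, Real.rpow_neg h1.le, hTdef, ← hc]
    have : (1 + r / p.d0) ^ p.alpha ≠ 0 := (Real.rpow_pos_of_pos h1 _).ne'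
    push_cast
    field_simp
  by_cases hI : I = ∞
  · have hempty : {h : Fin K ⊕ Fin O → Fin M → ℂ | ENNReal.ofReal T * (I + 1) ≤ ENNReal.ofReal
        (p.rho * p.pathLoss r * power (h (Sum.inl i)) (zfBeam h (Sum.inl i)))} = ∅ := by
      ext h
      have : ENNReal.ofReal T ≠ 0 := by simpa using hTpos
      simp [hI, ENNReal.mul_top this]
    rw [hempty, measure_empty]
    exact zero_le
  have hI1 : I + 1 = ENNReal.ofReal (I.toReal + 1) := by
    rw [ENNReal.ofReal_add ENNReal.toReal_nonneg zero_le_one, ENNReal.ofReal_toReal hI,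
      ENNReal.ofReal_one]
  have hIpos : 0 < I.toReal + 1 := by have := ENNReal.toReal_nonneg (a := I); linarith
  set x := T / (p.rho * p.pathLoss r) * (I.toReal + 1) with hx
  have hx0 : 0 < x := by positivity
  have hset : {h : Fin K ⊕ Fin O → Fin M → ℂ | ENNReal.ofReal T * (I + 1) ≤ ENNReal.ofReal
        (p.rho * p.pathLoss r * power (h (Sum.inl i)) (zfBeam h (Sum.inl i)))} =
      {h | x ≤ power (h (Sum.inl i)) (zfBeam h (Sum.inl i))} := by
    ext h
    have hpw : 0 ≤ power (h (Sum.inl i)) (zfBeam h (Sum.inl i)) := sq_nonneg _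
    simp only [Set.mem_ofPred_eq]
    rw [hI1, ← ENNReal.ofReal_mul hTpos.le, ENNReal.ofReal_le_ofReal_iff (by positivity), hx,
      div_mul_eq_mul_div, div_le_iff₀ (by positivity), mul_comm (power _ _)]
  have hv : (expNeg (ENNReal.ofReal (p.sArg ζ κ 1 r) * (I + 1))).toReal = Real.exp (-(c * x)) := by
    rw [hs, hI1, ← ENNReal.ofReal_mul (by positivity), expNeg_ofReal (by positivity),
      ENNReal.toReal_ofReal (Real.exp_pos _).le, mul_assoc, ← hx]
  -- The `K + O - 1` nulled directions leave `M - (K + O - 1) = ζ` degrees of freedom.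
  rw [hset, measure_le_power_zfBeam (d := ζ) (by simp; lia) _ hx0, hv]
  exact ENNReal.ofReal_le_ofReal (erlangTail_le hζ hx0.le)

lemma le_of_le_rate {Ω : Type*} {N : Network Ω M K O} (hp : p.Valid) (i : Fin K) {κ : ℝ} {ω : Ω}
    (h : κ ≤ p.w * N.rate p u i ω) :
    ENNReal.ofReal (p.tau * ((2 : ℝ) ^ (κ / p.w) - 1)) * (N.interference p u ω + 1) ≤
      ENNReal.ofReal (N.signal p u i ω) := by
  have hτ := hp.tau_pos
  have hγ : 0 ≤ N.sinr p u i ω := ENNReal.toReal_nonneg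
  have h1 : κ / p.w ≤ Real.logb 2 (1 + N.sinr p u i ω / p.tau) := by
    rw [div_le_iff₀' hp.w_pos]
    exact h
  rw [Real.le_logb_iff_rpow_le one_lt_two (by positivity)] at h1
  have h2 : p.tau * ((2 : ℝ) ^ (κ / p.w) - 1) ≤ N.sinr p u i ω := by
    rw [← le_div_iff₀' hτ]
    linarith
  exact ENNReal.mul_le_of_le_div ((ENNReal.ofReal_le_ofReal h2).trans ENNReal.ofReal_toReal_le)

lemma Network.Model.aemeasurable_interference (hN : N.Model P p u) :
    AEMeasurable (N.interference p u) P := by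
  have h1 := measurable_interferenceFun (M := M) (K := K) (O := O) (p := p) (u := u)
  have h2 : AEMeasurable (fun ω => (N.far ω, N.cross ω, N.other ω)) P :=
    hN.far_poisson.measurable.aemeasurable.prodMk
      (hN.cross_law.aemeasurable.prodMk hN.other_measurable.aemeasurable)
  have h3 := h1.comp_aemeasurable h2
  have h4 : N.interference p u =
      interferenceFun M K O p u ∘ fun ω => (N.far ω, N.cross ω, N.other ω) := rfl
  rw [h4]
  exact h3

variable [IsProbabilityMeasure P]

/-- The fading of the serving station is independent of the locations and all other channels
together, so these may be frozen and `measure_signal_le` applied pointwise. -/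
lemma Network.Model.measure_rate_le {ζ : ℕ} (hζ : 1 ≤ ζ) (hM : M + 1 = K + O + ζ) (hp : p.Valid)
    (hN : N.Model P p u) (i : Fin K) {κ : ℝ} (hκ : 0 ≤ κ) :
    P {ω | κ ≤ p.w * N.rate p u i ω} ≤
      ∫⁻ ω, ENNReal.ofReal (p.condBound ζ κ (N.rmin u ω) (N.interference p u ω)) ∂P := by
  have hnear := hN.near_poisson.measurable
  have hfar := hN.far_poisson.measurable
  have hown := hN.own_law.aemeasurable
  have hC : AEMeasurable (fun ω => (N.cross ω, N.other ω)) P :=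
    hN.cross_law.aemeasurable.prodMk hN.other_measurable.aemeasurable
  have hL : AEMeasurable (fun ω => (N.near ω, N.far ω)) P := (hnear.prodMk hfar).aemeasurable
  have hind := indepFun_prodMk_of_indepFun hL hown hC hN.indep_location_fading hN.indep_own
  let S : Set ((Fin K ⊕ Fin O → Fin M → ℂ) × (((ℕ → Plane) × (ℕ → Plane)) ×
      ((ℕ → Fin M → ℂ) × (ℕ → Fin K ⊕ Fin O → Fin M → ℂ)))) :=
    {q | ENNReal.ofReal (p.tau * ((2 : ℝ) ^ (κ / p.w) - 1)) *
        (interferenceFun M K O p u (q.2.1.2, q.2.2) + 1) ≤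
      ENNReal.ofReal (p.rho * p.pathLoss (⨅ m, dist (q.2.1.1 m) u) *
        power (q.1 (Sum.inl i)) (zfBeam q.1 (Sum.inl i)))}
  have hS : MeasurableSet S := by
    have h1 := measurable_interferenceFun (M := M) (K := K) (O := O) (p := p) (u := u)
    have h2 := measurable_pathLoss p
    have h3 := measurable_iInf_dist u
    have h4 := measurable_power (measurable_pi_apply (Sum.inl i))
      (measurable_zfBeam (M := M) (ι := Fin K ⊕ Fin O) (Sum.inl i))
    refine measurableSet_le (((h1.comp (by fun_prop)).add_const 1).const_mul _)
      (ENNReal.measurable_ofReal.comp (Measurable.mul ?_ (h4.comp measurable_fst)))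
    exact (h2.comp (h3.comp (by fun_prop))).const_mul _
  calc P {ω | κ ≤ p.w * N.rate p u i ω}
      ≤ P {ω | (N.own ω, (N.near ω, N.far ω), N.cross ω, N.other ω) ∈ S} :=
        measure_mono fun ω hω => le_of_le_rate hp i hω
    _ = ∫⁻ ω, P.map N.own {h | (h, (N.near ω, N.far ω), N.cross ω, N.other ω) ∈ S} ∂P :=
        measure_of_indepFun hown (hL.prodMk hC) hind hS
    _ ≤ _ := by
        refine lintegral_mono fun ω => ?_
        rw [hN.own_law.map_eq]
        exact measure_signal_le hζ hM hp i hκ (N.rmin_nonneg u ω) _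

/-- The points of `near` are independent of everything that determines the interference. Freezing
them leaves a Laplace transform at a level depending on the nearest distance alone. -/
lemma Network.Model.lintegral_expNeg_sArg (hp : p.Valid) (hN : N.Model P p u) (ζ : ℕ) (κ : ℝ)
    (j : ℕ) :
    ∫⁻ ω, expNeg (ENNReal.ofReal (p.sArg ζ κ j (N.rmin u ω)) * (N.interference p u ω + 1)) ∂P =
      ∫⁻ r in Set.Ioi 0, ENNReal.ofReal (deriv p.cdfNearest r) * N.laplace P p u (p.sArg ζ κ j r) := by
  have hnear := hN.near_poisson.measurable
  have hfar := hN.far_poisson.measurable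
  have hC : AEMeasurable (fun ω => (N.cross ω, N.other ω)) P :=
    hN.cross_law.aemeasurable.prodMk hN.other_measurable.aemeasurable
  have hCF := hC.prodMk hfar.aemeasurable
  have hLC : IndepFun (fun ω => (N.cross ω, N.other ω)) (fun ω => (N.near ω, N.far ω)) P :=
    (hN.indep_location_fading.comp measurable_id measurable_snd).symm
  have hind := indepFun_prodMk_of_indepFun hC hnear.aemeasurable hfar.aemeasurable hLC
    hN.indep_near_far
  have hI := measurable_interferenceFun (M := M) (K := K) (O := O) (p := p) (u := u)
  have hs := measurable_sArg p ζ κ j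
  have hr := measurable_iInf_dist u
  let Φ : (((ℕ → Fin M → ℂ) × (ℕ → Fin K ⊕ Fin O → Fin M → ℂ)) × (ℕ → Plane)) × (ℕ → Plane) →
      ℝ≥0∞ := fun q => expNeg (ENNReal.ofReal (p.sArg ζ κ j (⨅ m, dist (q.2 m) u)) *
        (interferenceFun M K O p u (q.1.2, q.1.1) + 1))
  have hΦ : Measurable Φ := by
    refine measurable_expNeg.comp (Measurable.mul ?_ ((hI.comp (by fun_prop)).add_const 1))
    exact ENNReal.measurable_ofReal.comp (hs.comp (hr.comp measurable_snd))
  have hlap : Measurable fun r => N.laplace P p u (p.sArg ζ κ j r) :=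
    antitone_laplace.measurable.comp hs
  have hrmin : Measurable (N.rmin u) := hr.comp hnear
  have hdens : Measurable fun r => ENNReal.ofReal (deriv p.cdfNearest r) :=
    ENNReal.measurable_ofReal.comp (measurable_deriv_cdfNearest p)
  calc _ = ∫⁻ ω, Φ (((N.cross ω, N.other ω), N.far ω), N.near ω) ∂P := rfl
    _ = ∫⁻ ω, ∫⁻ y, Φ (y, N.near ω) ∂(P.map fun ω => ((N.cross ω, N.other ω), N.far ω)) ∂P :=
        lintegral_of_indepFun hCF hnear.aemeasurable hind.symm hΦ
    _ = ∫⁻ ω, N.laplace P p u (p.sArg ζ κ j (N.rmin u ω)) ∂P := by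
        refine lintegral_congr fun ω => ?_
        rw [lintegral_map' (f := fun y => Φ (y, N.near ω))
          (hΦ.comp (by fun_prop)).aemeasurable hCF]
        rfl
    _ = ∫⁻ r, N.laplace P p u (p.sArg ζ κ j r) ∂(P.map (N.rmin u)) :=
        (lintegral_map hlap hrmin).symm
    _ = _ := by
        rw [hN.map_rmin hp, Params.nearestLaw, lintegral_withDensity_eq_lintegral_mul _ hdens hlap]
        rfl

lemma Network.Model.integrand_mul_eq (hp : p.Valid) (hK : 1 ≤ K) (hN : N.Model P p u) (ζ : ℕ)
    {κ : ℝ} (hκ : 0 ≤ κ) {r : ℝ} (hr : r ∈ Set.Ioi 0) :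
    p.integrand K ζ κ r * deriv p.cdfNearest r =
      ∑ j ∈ Finset.Icc 1 ζ, (ζ.choose j : ℝ) * (-1) ^ (j + 1) *
        (ENNReal.ofReal (deriv p.cdfNearest r) * N.laplace P p u (p.sArg ζ κ j r)).toReal := by
  rw [Params.integrand, Finset.sum_mul]
  refine Finset.sum_congr rfl fun j _ => ?_
  rw [hN.laplace_eq hp hK (hp.sArg_nonneg hκ j (le_of_lt hr)), ENNReal.toReal_mul,
    ENNReal.toReal_ofReal (hp.deriv_cdfNearest_nonneg (le_of_lt hr)),
    ENNReal.toReal_ofReal (by positivity)]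
  ring

lemma Network.Model.integrable_laplace (hp : p.Valid) (N : Network Ω M K O) (ζ : ℕ) (κ : ℝ)
    (j : ℕ) :
    IntegrableOn (fun r => (ENNReal.ofReal (deriv p.cdfNearest r) *
      N.laplace P p u (p.sArg ζ κ j r)).toReal) (Set.Ioi 0) := by
  have hlap : Measurable fun r => N.laplace P p u (p.sArg ζ κ j r) :=
    antitone_laplace.measurable.comp (measurable_sArg p ζ κ j)
  have hm := ((ENNReal.measurable_ofReal.comp (measurable_deriv_cdfNearest p)).mul hlap).ennreal_toReal
  refine Integrable.mono' hp.integrable_deriv_cdfNearest.integrableOn hm.aestronglyMeasurable ?_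
  filter_upwards [ae_restrict_mem measurableSet_Ioi] with r hr
  rw [Real.norm_of_nonneg ENNReal.toReal_nonneg, ENNReal.toReal_mul,
    ENNReal.toReal_ofReal (hp.deriv_cdfNearest_nonneg (le_of_lt hr))]
  have h1 := ENNReal.toReal_mono ENNReal.one_ne_top
    (laplace_le_one (N := N) (P := P) (p := p) (u := u) (p.sArg ζ κ j r))
  exact mul_le_of_le_one_right (hp.deriv_cdfNearest_nonneg (le_of_lt hr)) (by simpa using h1)

end model

end

end LSMIMO

/-! ### The rate bound -/

theorem theorem1 {Ω : Type*} [MeasurableSpace Ω] (P : Measure Ω) [IsProbabilityMeasure P]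
    (M K O ζ : ℕ) (hζ : 1 ≤ ζ) (hM : M + 1 = K + O + ζ)
    (p : LSMIMO.Params) (hp : p.Valid) (u : LSMIMO.Plane)
    (N : LSMIMO.Network Ω M K O) (hN : N.Model P p u)
    (i : Fin K) (κ : ℝ) (hκ : 0 ≤ κ) :
    (∀ r : ℝ, 0 < r → P.real {ω | N.rmin u ω ≤ r} = p.cdfNearest r) ∧
    IntegrableOn (fun r : ℝ => p.integrand K ζ κ r * deriv p.cdfNearest r) (Set.Ioi 0) ∧
    P.real {ω | κ ≤ p.w * N.rate p u i ω} ≤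
      ∫ r in Set.Ioi (0 : ℝ), p.integrand K ζ κ r * deriv p.cdfNearest r := by
  have hK : 1 ≤ K := Nat.one_le_iff_ne_zero.2 fun h => (h ▸ i).elim0
  have hint := fun j => LSMIMO.Network.Model.integrable_laplace (P := P) (u := u) hp N ζ κ j
  have heq : ∀ r ∈ Set.Ioi (0 : ℝ), _ = _ := fun r hr => hN.integrand_mul_eq hp hK ζ hκ hr
  have hrm : Measurable (N.rmin u) :=
    (LSMIMO.measurable_iInf_dist u).comp hN.near_poisson.measurable
  have hterm : ∀ j, AEMeasurable (fun ω => LSMIMO.expNeg (ENNReal.ofReal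
      (p.sArg ζ κ j (N.rmin u ω)) * (N.interference p u ω + 1))) P := fun j =>
    LSMIMO.measurable_expNeg.comp_aemeasurable ((ENNReal.measurable_ofReal.comp
      ((LSMIMO.measurable_sArg p ζ κ j).comp hrm)).aemeasurable.mul
        (hN.aemeasurable_interference.add_const 1))
  have hlt : ∀ x, LSMIMO.expNeg x < ∞ := fun x => (LSMIMO.expNeg_ne_top x).lt_top
  have htermint : ∀ j, Integrable (fun ω => (LSMIMO.expNeg (ENNReal.ofReal
      (p.sArg ζ κ j (N.rmin u ω)) * (N.interference p u ω + 1))).toReal) P := by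
    intro j
    refine Integrable.mono' (integrable_const (1 : ℝ))
      (hterm j).ennreal_toReal.aestronglyMeasurable (Filter.Eventually.of_forall fun ω => ?_)
    rw [Real.norm_of_nonneg ENNReal.toReal_nonneg]
    simpa using ENNReal.toReal_mono ENNReal.one_ne_top (LSMIMO.expNeg_le_one _)
  refine ⟨fun r hr => hN.measure_rmin_le hp hr, ?_, ?_⟩
  · rw [integrableOn_congr_fun heq measurableSet_Ioi]
    exact integrable_finsetSum _ fun j _ => (hint j).const_mul _
  · have h1 := hN.measure_rate_le hζ hM hp i hκ
    -- The summands alternate in sign, so the sum is split only after passing to Bochner integrals;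
    -- nonnegativity of the whole conditional bound allows the passage.
    have h2 : Integrable (fun ω => p.condBound ζ κ (N.rmin u ω) (N.interference p u ω)) P :=
      integrable_finsetSum _ fun j _ => (htermint j).const_mul _
    rw [← ofReal_integral_eq_lintegral_ofReal h2 (Filter.Eventually.of_forall fun ω =>
      p.condBound_nonneg ζ κ _ _)] at h1
    refine (ENNReal.toReal_le_of_le_ofReal (integral_nonneg fun ω =>
      p.condBound_nonneg ζ κ _ _) h1).trans_eq ?_
    rw [setIntegral_congr_fun measurableSet_Ioi heq,
      integral_finsetSum _ fun j _ => (hint j).const_mul _]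
    simp only [LSMIMO.Params.condBound]
    rw [integral_finsetSum _ fun j _ => (htermint j).const_mul _]
    refine Finset.sum_congr rfl fun j _ => ?_
    -- Apart from its signed coefficient each term is nonnegative, so both integrals can be compared
    -- as extended nonnegative ones.
    rw [integral_const_mul, integral_const_mul, integral_toReal (hterm j)
      (Filter.Eventually.of_forall fun ω => hlt _), hN.lintegral_expNeg_sArg hp]
    congr 1
    refine (integral_toReal ?_ ?_).symm
    · exact ((ENNReal.measurable_ofReal.comp (LSMIMO.measurable_deriv_cdfNearest p)).mul
        (LSMIMO.antitone_laplace.measurable.comp (LSMIMO.measurable_sArg p ζ κ j))).aemeasurable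
    · exact Filter.Eventually.of_forall fun r => ENNReal.mul_lt_top ENNReal.ofReal_lt_top
        ((LSMIMO.laplace_le_one _).trans_lt ENNReal.one_lt_top)
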